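/- Let $f:\mathbb R^n\to\mathbb R$, $g:\mathbb R^n\to\mathbb R^m$ and $G:\mathbb R^n\to\mathbb S^d$ be twice continuously differentiable, where $\mathbb S^d$ is the space of real symmetric $d\times d$ matrices with $\langle V,W\rangle=\mathrm{tr}(V^\top W)$ and Frobenius norm $\|\cdot\|_F$. Consider the problem of minimizing $f(x)$ subject to $g(x)=0$, $G(x)\succeq O$. For $X\in\mathbb S^d$, $[X]_+$ is obtained by replacing each eigenvalue $t$ of $X$ by $\max\{t,0\}$, $X^\dagger$ is the Moore–Penrose inverse, and $V\circledcirc W=\frac12(VW+WV)$. Put $$\mathcal F(x;\gamma)=f(x)+\tfrac{\gamma}{2}\|g(x)\|^2+\tfrac{\gamma}{4}\mathrm{tr}([-G(x)]_+^4),\qquad \mathcal P(x)=\tfrac12\|g(x)\|^2+\tfrac14\mathrm{tr}([-G(x)]_+^4),$$ $$L(x,y,Z)=f(x)-\langle g(x),y\rangle-\langle G(x),Z\rangle,\qquad \sigma(x,Z)=\big[\,2\langle Z,G_i(x)G(x)^\dagger G_j(x)\rangle\,\big]_{i,j=1}^n,\quad G_i=\partial G/\partial x_i .$$ **Sequential optimality.**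 Let $\bar x$ be feasible. For $x$ near $\bar x$ let $S(x,\bar x)$ be the set of $h\in\mathbb R^n$ with $\nabla g(x)^\top h=0$ and $U^\top(\mathrm DG(x)h)U=O$, where the columns of $U$ form an orthonormal basis of the space spanned by the eigenvectors for the $\dim\ker G(\bar x)$ smallest eigenvalues of $G(x)$. A sequence $(x_k,y_k,Z_k,\varepsilon_k)\in\mathbb R^n\times\mathbb R^m\times\mathbb S^d_+\times(0,\infty)$ is an *AKKT2 sequence* corresponding to $\bar x$ if $x_k\to\bar x$, $\varepsilon_k\to0$, $\nabla_xL(x_k,y_k,Z_k)\to0$, and (a) there are orthogonal matrices $P_k\to P$ with $G(\bar x)=P\,\mathrm{diag}(\mu_1,\dots,\mu_d)P^\top$ and $Z_k=P_k\,\mathrm{diag}(\zeta_1^k,\dots,\zeta_d^k)P_k^\top$ such that, for each $j$ with $\mu_j>0$, $\zeta_j^k=0$ for all sufficiently large $k$; (b) for all sufficiently large $k$ and all $h\in S(x_k,\bar x)$, $h^\top(\nabla^2_{xx}L(x_k,y_k,Z_k)+\sigma(x_k,Z_k))h\ge-\varepsilon_k\|h\|^2$. It is a *CAKKT2 sequence*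 if (a) is replaced by $G(x_k)\circledcirc Z_k\to O$. A feasible point $\bar x$ is an AKKT2 (CAKKT2) point if it has an AKKT2 (CAKKT2) sequence. **Algorithm.** Let $\eta\in(0,1)$, $\theta>1$, $\delta_k\in(0,1)$ with $\delta_k\to0$, $x_0$ feasible, $\widehat x_0=x_0$, $\gamma_0>0$, and $u_k=\max\{\|g(x_k)\|,\|[-G(x_k)]_+\|_F\}$. For $k=0,1,2,\dots$ a descent method (such as a trust region method) for $\mathcal F(\cdot\,;\gamma_k)$ started at $\widehat x_k$ returns $x_{k+1}$ with $\mathcal F(x_{k+1};\gamma_k)\le\mathcal F(\widehat x_k;\gamma_k)$ and $$\|\nabla\mathcal F(x_{k+1};\gamma_k)\|\le\delta_k,\qquad \nabla^2\mathcal F(x_{k+1};\gamma_k)+\delta_kI\succeq O.$$ Then $\widehat x_{k+1}=x_{k+1}$ if $\mathcal F(x_{k+1};\gamma_k)\le f(x_0)$, and $\widehat x_{k+1}=x_0$ otherwise; $\gamma_{k+1}=\gamma_k$ if $k=0$ or $u_{k+1}\le\eta u_k$, and $\gamma_{k+1}=\theta\gamma_k$ otherwise. **Theorem (global convergence).** Let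 $\{x_k\}$ be generated by the algorithm, and let $y_k=-\gamma_{k-1}g(x_k)$, $Z_k=\gamma_{k-1}[-G(x_k)]_+^3$, $\varepsilon_k=\delta_{k-1}$ for $k\ge1$. Assume that $\{f(x_k)\}$ is bounded below (this holds, for instance, if $\{x_k\}$ is bounded or convergent). Let $\bar x$ be an accumulation point of $\{x_k\}$. Then: (i) $\bar x$ is an AKKT2 point, and every subsequence (with indices $k\ge1$) along which $x_k\to\bar x$ has a further subsequence along which $(x_k,y_k,Z_k,\varepsilon_k)$ is an AKKT2 sequence corresponding to $\bar x$. (ii) If $\bar x$ satisfies the generalized Polyak–Łojasiewicz inequality, that is, if there are $\nu>0$ and a function $\Psi$ with $\Psi(x)\to0$ as $x\to\bar x$ such that $|\mathcal P(x)-\mathcal P(\bar x)|\le\Psi(x)\|\nabla\mathcal P(x)\|$ whenever $\|x-\bar x\|\le\nu$, then $\bar x$ is a CAKKT2 point, and along every subsequence (with indices $k\ge1$) with $x_k\to\bar x$, $(x_k,y_k,Z_k,\varepsilon_k)$ is a CAKKT2 sequence corresponding to $\bar x$. -/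

import Mathlib

open Filter Topology

/-- The nonlinear semidefinite program `min f x` subject to `g x = 0`, `G x ⪰ 0`, where
`f`, `g`, `G` are twice continuously differentiable and `G` takes symmetric values. (A matrix
valued function is `C²` if and only if its entries are.) -/
structure NSDP (n m d : ℕ) where
  f : EuclideanSpace ℝ (Fin n) → ℝ
  g : EuclideanSpace ℝ (Fin n) → EuclideanSpace ℝ (Fin m)
  G : EuclideanSpace ℝ (Fin n) → Matrix (Fin d) (Fin d) ℝ
  contDiff_f : ContDiff ℝ 2 f
  contDiff_g : ContDiff ℝ 2 g
  contDiff_G : ∀ i j, ContDiff ℝ 2 (fun x => G x i j)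
  isSymm_G : ∀ x, (G x).IsSymm

namespace NSDP

noncomputable section

/-! ### Matrices -/

/-- The trace inner product `⟨V, W⟩ = tr (Vᵀ W)`. -/
def matInner {d : ℕ} (V W : Matrix (Fin d) (Fin d) ℝ) : ℝ := (V.transpose * W).trace

/-- The Frobenius norm. -/
def frobNorm {d : ℕ} (W : Matrix (Fin d) (Fin d) ℝ) : ℝ := √(matInner W W)

/-- The symmetrized product `(VW + WV)/2`. -/
def symProd {d : ℕ} (V W : Matrix (Fin d) (Fin d) ℝ) : Matrix (Fin d) (Fin d) ℝ :=
  (1 / 2 : ℝ) • (V * W + W * V)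

/-- `[X]₊` for a symmetric matrix `X`: every eigenvalue `t` in an orthogonal diagonalization of
`X` is replaced by `max t 0`. -/
def matPos {d : ℕ} (X : Matrix (Fin d) (Fin d) ℝ) : Matrix (Fin d) (Fin d) ℝ :=
  cfc (fun t : ℝ => max t 0) X

/-- The Moore-Penrose inverse of a symmetric matrix `X`: every nonzero eigenvalue `t` in an
orthogonal diagonalization of `X` is replaced by `t⁻¹`, and zero eigenvalues are kept (in Lean,
`(0 : ℝ)⁻¹ = 0`). -/
def pinv {d : ℕ} (X : Matrix (Fin d) (Fin d) ℝ) : Matrix (Fin d) (Fin d) ℝ :=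
  cfc (fun t : ℝ => t⁻¹) X

/-- The four Penrose equations, which characterize the Moore-Penrose inverse. -/
theorem pinv_penrose {d : ℕ} {X : Matrix (Fin d) (Fin d) ℝ} (hX : X.IsSymm) :
    X * pinv X * X = X ∧ pinv X * X * pinv X = pinv X ∧
      (X * pinv X).IsSymm ∧ (pinv X * X).IsSymm := by
  have hs : IsSelfAdjoint X := by
    show star X = X
    rw [Matrix.star_eq_conjTranspose, Matrix.conjTranspose_eq_transpose_of_trivial]
    exact hX
  have hc : ∀ u : ℝ → ℝ, ContinuousOn u (spectrum ℝ X) := fun u =>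
    (Matrix.finite_real_spectrum (A := X)).continuousOn u
  have hsym : ∀ u : ℝ → ℝ, (cfc u X).IsSymm := by
    intro u
    have h : star (cfc u X) = cfc u X := (cfc_predicate u X : IsSelfAdjoint (cfc u X))
    rw [Matrix.star_eq_conjTranspose, Matrix.conjTranspose_eq_transpose_of_trivial] at h
    exact h
  have hid : X = cfc (fun t : ℝ => t) X := (cfc_id' ℝ X).symm
  have h1 : X * pinv X = cfc (fun t : ℝ => t * t⁻¹) X := by
    rw [cfc_mul (fun t : ℝ => t) (fun t : ℝ => t⁻¹) X (hc _) (hc _), ← hid]; rfl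
  have h2 : pinv X * X = cfc (fun t : ℝ => t⁻¹ * t) X := by
    rw [cfc_mul (fun t : ℝ => t⁻¹) (fun t : ℝ => t) X (hc _) (hc _), ← hid]; rfl
  refine ⟨?_, ?_, ?_, ?_⟩
  · have h3 : X * pinv X * X = cfc (fun t : ℝ => t * t⁻¹ * t) X := by
      rw [cfc_mul (fun t : ℝ => t * t⁻¹) (fun t : ℝ => t) X (hc _) (hc _), ← hid, h1]
    rw [h3]
    simp only [mul_inv_mul_cancel]
    exact hid.symm
  · have h3 : pinv X * X * pinv X = cfc (fun t : ℝ => t⁻¹ * t * t⁻¹) X := by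
      rw [cfc_mul (fun t : ℝ => t⁻¹ * t) (fun t : ℝ => t⁻¹) X (hc _) (hc _), h2]; rfl
    have h4 : (fun t : ℝ => t⁻¹ * t * t⁻¹) = fun t : ℝ => t⁻¹ := by
      funext t
      simpa using mul_inv_mul_cancel t⁻¹
    rw [h3, h4]
    rfl
  · rw [h1]; exact hsym _
  · rw [h2]; exact hsym _

/-! ### Derivatives -/

/-- The Hessian matrix of a real function. -/
def hessian {n : ℕ} (φ : EuclideanSpace ℝ (Fin n) → ℝ) (x : EuclideanSpace ℝ (Fin n)) :
    Matrix (Fin n) (Fin n) ℝ :=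
  Matrix.of fun i j =>
    fderiv ℝ (fderiv ℝ φ) x (EuclideanSpace.single i 1) (EuclideanSpace.single j 1)

variable {n m d : ℕ}

/-- The directional derivative `DG(x) h`, computed entrywise. -/
def DG (p : NSDP n m d) (x h : EuclideanSpace ℝ (Fin n)) : Matrix (Fin d) (Fin d) ℝ :=
  Matrix.of fun i j => fderiv ℝ (fun z => p.G z i j) x h

/-- The partial derivative `G_i(x) = ∂G(x)/∂x_i`. -/
def partialG (p : NSDP n m d) (i : Fin n) (x : EuclideanSpace ℝ (Fin n)) :
    Matrix (Fin d) (Fin d) ℝ :=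
  p.DG x (EuclideanSpace.single i 1)

/-! ### Optimality conditions -/

/-- Feasibility: `g(x) = 0` and `G(x) ⪰ 0`. -/
def Feasible (p : NSDP n m d) (x : EuclideanSpace ℝ (Fin n)) : Prop :=
  p.g x = 0 ∧ (p.G x).PosSemidef

/-- The Lagrange function `L(x, y, Z) = f(x) - ⟨g(x), y⟩ - ⟨G(x), Z⟩`. -/
def lagrangian (p : NSDP n m d) (x : EuclideanSpace ℝ (Fin n)) (y : EuclideanSpace ℝ (Fin m))
    (Z : Matrix (Fin d) (Fin d) ℝ) : ℝ :=
  p.f x - inner ℝ (p.g x) y - matInner (p.G x) Z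

/-- The sigma-term, with entries `2 ⟨Z, G_i(x) G(x)† G_j(x)⟩`. -/
def sigmaTerm (p : NSDP n m d) (x : EuclideanSpace ℝ (Fin n)) (Z : Matrix (Fin d) (Fin d) ℝ) :
    Matrix (Fin n) (Fin n) ℝ :=
  Matrix.of fun i j => 2 * matInner Z (p.partialG i x * pinv (p.G x) * p.partialG j x)

/-- `{(x_k, y_k, Z_k)}` is an AKKT sequence corresponding to the point `xbar`. -/
def IsAKKTSeq (p : NSDP n m d) (xbar : EuclideanSpace ℝ (Fin n))
    (x : ℕ → EuclideanSpace ℝ (Fin n)) (y : ℕ → EuclideanSpace ℝ (Fin m))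
    (Z : ℕ → Matrix (Fin d) (Fin d) ℝ) : Prop :=
  (∀ k, (Z k).PosSemidef) ∧
  Tendsto x atTop (𝓝 xbar) ∧
  Tendsto (fun k => gradient (fun z => p.lagrangian z (y k) (Z k)) (x k)) atTop (𝓝 0) ∧
  ∃ (P : Matrix (Fin d) (Fin d) ℝ) (Q : ℕ → Matrix (Fin d) (Fin d) ℝ)
    (μ : Fin d → ℝ) (ζ : ℕ → Fin d → ℝ),
    P ∈ Matrix.orthogonalGroup (Fin d) ℝ ∧
    (∀ k, Q k ∈ Matrix.orthogonalGroup (Fin d) ℝ) ∧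
    Tendsto Q atTop (𝓝 P) ∧
    p.G xbar = P * Matrix.diagonal μ * P.transpose ∧
    (∀ k, Z k = Q k * Matrix.diagonal (ζ k) * (Q k).transpose) ∧
    ∀ j, 0 < μ j → ∃ K, ∀ k ≥ K, ζ k j = 0

/-- `{(x_k, y_k, Z_k)}` is a CAKKT sequence corresponding to the point `xbar`. -/
def IsCAKKTSeq (p : NSDP n m d) (xbar : EuclideanSpace ℝ (Fin n))
    (x : ℕ → EuclideanSpace ℝ (Fin n)) (y : ℕ → EuclideanSpace ℝ (Fin m))
    (Z : ℕ → Matrix (Fin d) (Fin d) ℝ) : Prop :=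
  (∀ k, (Z k).PosSemidef) ∧
  Tendsto x atTop (𝓝 xbar) ∧
  Tendsto (fun k => gradient (fun z => p.lagrangian z (y k) (Z k)) (x k)) atTop (𝓝 0) ∧
  Tendsto (fun k => symProd (p.G (x k)) (Z k)) atTop (𝓝 0)

/-- The columns of `V` form an orthonormal basis of a space spanned by eigenvectors associated
with the `r` smallest eigenvalues of the symmetric matrix `A`: here `A = Q diag(μ) Qᵀ` is an
orthogonal diagonalization with the eigenvalues `μ` in descending order. -/
def IsSmallestEigenbasis (A : Matrix (Fin d) (Fin d) ℝ) (r : ℕ)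
    (V : Matrix (Fin d) (Fin r) ℝ) : Prop :=
  V.transpose * V = 1 ∧
  ∃ (Q : Matrix (Fin d) (Fin d) ℝ) (μ : Fin d → ℝ),
    Q ∈ Matrix.orthogonalGroup (Fin d) ℝ ∧ Antitone μ ∧
    A = Q * Matrix.diagonal μ * Q.transpose ∧
    Submodule.span ℝ (Set.range V.col) = Submodule.span ℝ (Q.col '' {j | d - r ≤ (j : ℕ)})

/-- The perturbed critical subspace `S(x, xbar)`: all `h` with `∇g(x)ᵀ h = 0` and
`Uᵀ (DG(x) h) U = 0`, where the columns of `U` form an orthonormal basis of the space spanned by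
the eigenvectors for the `r` smallest eigenvalues of `G(x)` and `r = dim Ker G(xbar)`. For `x`
close to a feasible `xbar` that space is unique, and the condition depends only on the space and
not on its basis `U`. -/
def perturbedCriticalSubspace (p : NSDP n m d) (xbar x : EuclideanSpace ℝ (Fin n)) :
    Set (EuclideanSpace ℝ (Fin n)) :=
  {h | fderiv ℝ p.g x h = 0 ∧
    ∃ U : Matrix (Fin d)
        (Fin (Module.finrank ℝ (LinearMap.ker (Matrix.toLin' (p.G xbar))))) ℝ,
      IsSmallestEigenbasis (p.G x) _ U ∧ U.transpose * p.DG x h * U = 0}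

/-- The second-order part that the AKKT2 and the CAKKT2 conditions have in common. -/
def SecondOrderSeq (p : NSDP n m d) (xbar : EuclideanSpace ℝ (Fin n))
    (x : ℕ → EuclideanSpace ℝ (Fin n)) (y : ℕ → EuclideanSpace ℝ (Fin m))
    (Z : ℕ → Matrix (Fin d) (Fin d) ℝ) (ε : ℕ → ℝ) : Prop :=
  (∀ k, 0 < ε k) ∧ Tendsto ε atTop (𝓝 0) ∧
  ∃ N : ℕ, ∀ k ≥ N, ∀ h ∈ p.perturbedCriticalSubspace xbar (x k),
    - ε k * ‖h‖ ^ 2 ≤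
      h.ofLp ⬝ᵥ ((hessian (fun z => p.lagrangian z (y k) (Z k)) (x k) +
        p.sigmaTerm (x k) (Z k)).mulVec h.ofLp)

/-- `{(x_k, y_k, Z_k, ε_k)}` is an AKKT2 sequence corresponding to the point `xbar`. -/
def IsAKKT2Seq (p : NSDP n m d) (xbar : EuclideanSpace ℝ (Fin n))
    (x : ℕ → EuclideanSpace ℝ (Fin n)) (y : ℕ → EuclideanSpace ℝ (Fin m))
    (Z : ℕ → Matrix (Fin d) (Fin d) ℝ) (ε : ℕ → ℝ) : Prop :=
  p.IsAKKTSeq xbar x y Z ∧ p.SecondOrderSeq xbar x y Z ε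

/-- `xbar` is an AKKT2 point. -/
def IsAKKT2Point (p : NSDP n m d) (xbar : EuclideanSpace ℝ (Fin n)) : Prop :=
  p.Feasible xbar ∧ ∃ x y Z ε, p.IsAKKT2Seq xbar x y Z ε

/-- `{(x_k, y_k, Z_k, ε_k)}` is a CAKKT2 sequence corresponding to the point `xbar`. -/
def IsCAKKT2Seq (p : NSDP n m d) (xbar : EuclideanSpace ℝ (Fin n))
    (x : ℕ → EuclideanSpace ℝ (Fin n)) (y : ℕ → EuclideanSpace ℝ (Fin m))
    (Z : ℕ → Matrix (Fin d) (Fin d) ℝ) (ε : ℕ → ℝ) : Prop :=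
  p.IsCAKKTSeq xbar x y Z ∧ p.SecondOrderSeq xbar x y Z ε

/-- `xbar` is a CAKKT2 point. -/
def IsCAKKT2Point (p : NSDP n m d) (xbar : EuclideanSpace ℝ (Fin n)) : Prop :=
  p.Feasible xbar ∧ ∃ x y Z ε, p.IsCAKKT2Seq xbar x y Z ε

/-! ### The penalty method -/

/-- The infeasibility measure `½ ‖g(x)‖² + ¼ tr([-G(x)]₊⁴)`. -/
def infeasibility (p : NSDP n m d) (x : EuclideanSpace ℝ (Fin n)) : ℝ :=
  1 / 2 * ‖p.g x‖ ^ 2 + 1 / 4 * (matPos (-p.G x) ^ 4).trace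

/-- The penalty function `f(x) + (γ/2) ‖g(x)‖² + (γ/4) tr([-G(x)]₊⁴)`. -/
def penalty (p : NSDP n m d) (γ : ℝ) (x : EuclideanSpace ℝ (Fin n)) : ℝ :=
  p.f x + γ / 2 * ‖p.g x‖ ^ 2 + γ / 4 * (matPos (-p.G x) ^ 4).trace

/-- The generalized Polyak-Lojasiewicz inequality at `xbar`. Only the values of `Ψ` on the closed
ball matter. -/
def GeneralizedPL (p : NSDP n m d) (xbar : EuclideanSpace ℝ (Fin n)) : Prop :=
  ∃ ν > 0, ∃ Ψ : EuclideanSpace ℝ (Fin n) → ℝ,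
    Tendsto Ψ (𝓝[≠] xbar) (𝓝 0) ∧
    ∀ x ∈ Metric.closedBall xbar ν,
      |p.infeasibility x - p.infeasibility xbar| ≤ Ψ x * ‖gradient p.infeasibility x‖

/-- The measure `max {‖g(x)‖, ‖[-G(x)]₊‖_F}` used in the update of the penalty parameter. -/
def violation (p : NSDP n m d) (x : EuclideanSpace ℝ (Fin n)) : ℝ :=
  max ‖p.g x‖ (frobNorm (matPos (-p.G x)))

/-- The sequences `x` (iterates), `xhat` (starting points for the subproblems), `γ` (penalty
parameters) and `δ` (tolerances) are generated by the penalty method with the parameters `η`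
and `θ`. The subproblem solver is a descent method started at `xhat k` (a trust region method
accepts only steps that decrease the objective), which is what `descent` records. -/
structure IsPenaltyRun (p : NSDP n m d) (η θ : ℝ) (δ γ : ℕ → ℝ)
    (x xhat : ℕ → EuclideanSpace ℝ (Fin n)) : Prop where
  eta_mem : η ∈ Set.Ioo (0 : ℝ) 1
  one_lt_theta : 1 < θ
  delta_mem : ∀ k, δ k ∈ Set.Ioo (0 : ℝ) 1
  delta_tendsto : Tendsto δ atTop (𝓝 0)
  feasible_zero : p.Feasible (x 0)
  xhat_zero : xhat 0 = x 0
  gamma_zero : 0 < γ 0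
  descent : ∀ k, p.penalty (γ k) (x (k + 1)) ≤ p.penalty (γ k) (xhat k)
  gradient_le : ∀ k, ‖gradient (p.penalty (γ k)) (x (k + 1))‖ ≤ δ k
  hessian_posSemidef : ∀ k,
    (hessian (p.penalty (γ k)) (x (k + 1)) + δ k • (1 : Matrix (Fin n) (Fin n) ℝ)).PosSemidef
  xhat_succ : ∀ k,
    xhat (k + 1) = if p.penalty (γ k) (x (k + 1)) ≤ p.f (x 0) then x (k + 1) else x 0
  gamma_succ : ∀ k,
    γ (k + 1) =
      if k = 0 ∨ p.violation (x (k + 1)) ≤ η * p.violation (x k) then γ k else θ * γ k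

end

end NSDP

/-!
At a point `x` the penalty function with parameter `γ` and the Lagrange function with multipliers
`y = -γ g(x)`, `Z = γ [-G(x)]₊³` have the same gradient, so the iterates are approximately
stationary for the Lagrange function. The Hessian of the penalty function exceeds that of the
Lagrange function by `γ ‖Dg(x) h‖²` and a Daleckii–Krein term in `DG(x) h`, whose weights are the
divided differences of `t ↦ (max t 0)³` at pairs of eigenvalues of `-G(x)`. On the perturbed
critical subspace `h` only meets pairs with a large eigenvalue `a > 0` of `G(x)`. For such a pair
`a, b` the divided difference at `-a, -b` is at most `(max (-b) 0)³ / a`, which is the weight of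
that pair in the sigma-term; the sigma-term therefore dominates.

Along a convergent subsequence of iterates the eigenvectors of `G` converge by compactness of the
orthogonal group, after passing to a further subsequence, and they diagonalize the multipliers
too. Under the generalized Polyak-Łojasiewicz inequality `γ 𝒫(x) → 0`, because `γ ∇𝒫(x)` converges
to `-∇f(xbar)`; this controls `G(x) ⊚ Z = -γ [-G(x)]₊⁴`.

Accumulation points are feasible: either the penalty parameters tend to infinity while the penalty
values stay bounded, or the violation eventually decays geometrically.
-/

namespace NSDP

noncomputable section

/-! ### Orthogonal diagonalization -/

section ConjDiagonal

open Matrix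

variable {ι : Type*} [Fintype ι] [DecidableEq ι]

/-- The symmetric matrix `Q diag(l) Qᵀ` with eigenvectors the columns of the orthogonal matrix `Q`
and eigenvalues `l`. It is a ⋆-algebra homomorphism in `l`, so that matrices diagonalized by the
same `Q` are computed with eigenvalue by eigenvalue. -/
def conjDiagonal (Q : orthogonalGroup ι ℝ) : (ι → ℝ) →⋆ₐ[ℝ] Matrix ι ι ℝ where
  toAlgHom := (Unitary.conjStarAlgAut ℝ (Matrix ι ι ℝ) Q : _ →ₐ[ℝ] _).comp (diagonalAlgHom ℝ)
  map_star' l := by simp [Unitary.conjStarAlgAut_apply, star_eq_conjTranspose, mul_assoc]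

theorem conjDiagonal_apply (Q : orthogonalGroup ι ℝ) (l : ι → ℝ) :
    conjDiagonal Q l = (Q : Matrix ι ι ℝ) * diagonal l * (Q : Matrix ι ι ℝ)ᵀ :=
  rfl

@[simp]
theorem transpose_mul_coe (Q : orthogonalGroup ι ℝ) :
    (Q : Matrix ι ι ℝ)ᵀ * (Q : Matrix ι ι ℝ) = 1 :=
  (mem_orthogonalGroup_iff' ι ℝ).1 Q.2

@[simp]
theorem coe_mul_transpose (Q : orthogonalGroup ι ℝ) :
    (Q : Matrix ι ι ℝ) * (Q : Matrix ι ι ℝ)ᵀ = 1 :=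
  (mem_orthogonalGroup_iff ι ℝ).1 Q.2

theorem transpose_mul_conjDiagonal (Q : orthogonalGroup ι ℝ) (l : ι → ℝ) :
    (Q : Matrix ι ι ℝ)ᵀ * conjDiagonal Q l = diagonal l * (Q : Matrix ι ι ℝ)ᵀ := by
  rw [conjDiagonal_apply, ← Matrix.mul_assoc, ← Matrix.mul_assoc, transpose_mul_coe, one_mul]

theorem isSymm_conjDiagonal (Q : orthogonalGroup ι ℝ) (l : ι → ℝ) : (conjDiagonal Q l).IsSymm :=
  (map_star (conjDiagonal Q) l).symm

theorem exists_eq_conjDiagonal {X : Matrix ι ι ℝ} (hX : X.IsSymm) :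
    ∃ (Q : orthogonalGroup ι ℝ) (l : ι → ℝ), X = conjDiagonal Q l :=
  have hX : X.IsHermitian := hX
  ⟨hX.eigenvectorUnitary, hX.eigenvalues, hX.spectral_theorem⟩

theorem spectrum_conjDiagonal (Q : orthogonalGroup ι ℝ) (l : ι → ℝ) :
    spectrum ℝ (conjDiagonal Q l) = Set.range l :=
  (AlgEquiv.spectrum_eq (Unitary.conjStarAlgAut ℝ (Matrix ι ι ℝ) Q) _).trans (spectrum_diagonal l)

theorem cfc_conjDiagonal (f : ℝ → ℝ) (Q : orthogonalGroup ι ℝ) (l : ι → ℝ) :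
    cfc f (conjDiagonal Q l) = conjDiagonal Q (f ∘ l) := by
  set q : Polynomial ℝ := Lagrange.interpolate (Finset.univ.image l) id f
  have hq (i : ι) : q.eval (l i) = f (l i) :=
    Lagrange.eval_interpolate_at_node f (Set.injOn_id _) (Finset.mem_image_of_mem l (by simp))
  calc cfc f (conjDiagonal Q l) = cfc q.eval (conjDiagonal Q l) := cfc_congr fun t ht => by
        obtain ⟨i, rfl⟩ := (spectrum_conjDiagonal Q l).subset ht
        exact (hq i).symm
    _ = Polynomial.aeval (conjDiagonal Q l) q :=
        cfc_polynomial q _ (isSymm_conjDiagonal Q l)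
    _ = conjDiagonal Q (Polynomial.aeval l q) :=
        Polynomial.aeval_algHom_apply (conjDiagonal Q) l q
    _ = conjDiagonal Q (f ∘ l) := congrArg _ <| funext fun i => by
        simp [hq]

theorem trace_conjDiagonal (Q : orthogonalGroup ι ℝ) (l : ι → ℝ) :
    (conjDiagonal Q l).trace = ∑ i, l i := by
  rw [conjDiagonal_apply, trace_mul_comm, ← Matrix.mul_assoc, transpose_mul_coe, one_mul,
    trace_diagonal]

theorem posSemidef_conjDiagonal_iff {Q : orthogonalGroup ι ℝ} {l : ι → ℝ} :
    (conjDiagonal Q l).PosSemidef ↔ ∀ i, 0 ≤ l i := by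
  rw [← posSemidef_diagonal_iff, conjDiagonal_apply]
  exact (Group.isUnit Q |>.map (orthogonalGroup ι ℝ).subtype).posSemidef_star_right_conjugate_iff

theorem rank_conjDiagonal (Q : orthogonalGroup ι ℝ) (l : ι → ℝ) :
    (conjDiagonal Q l).rank = Fintype.card {i // l i ≠ 0} := by
  rw [conjDiagonal_apply, rank_mul_eq_left_of_isUnit_det _ _ (isUnit_det_of_left_inverse
    (coe_mul_transpose Q)), rank_mul_eq_right_of_isUnit_det _ _ (isUnit_det_of_left_inverse
    (transpose_mul_coe Q)), rank_diagonal]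

theorem abs_conjDiagonal_le (Q : orthogonalGroup ι ℝ) (l : ι → ℝ) (i j : ι) :
    |conjDiagonal Q l i j| ≤ ∑ k, |l k| := by
  rw [conjDiagonal_apply, Matrix.mul_apply]
  simp only [mul_diagonal, transpose_apply]
  refine (Finset.abs_sum_le_sum_abs _ _).trans (Finset.sum_le_sum fun k _ => ?_)
  have hik : |(Q : Matrix ι ι ℝ) i k| ≤ 1 := entry_norm_bound_of_unitary Q.2 i k
  have hjk : |(Q : Matrix ι ι ℝ) j k| ≤ 1 := entry_norm_bound_of_unitary Q.2 j k
  calc |(Q : Matrix ι ι ℝ) i k * l k * (Q : Matrix ι ι ℝ) j k|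
      = |(Q : Matrix ι ι ℝ) i k| * |l k| * |(Q : Matrix ι ι ℝ) j k| := by simp only [abs_mul]
    _ ≤ 1 * |l k| * 1 := by gcongr
    _ = |l k| := by ring

theorem abs_apply_le_trace {κ : Type*} [Fintype κ] {X : Matrix κ κ ℝ} (hX : X.PosSemidef)
    (i j : κ) : |X i j| ≤ X.trace := by
  classical
  obtain ⟨Q, l, rfl⟩ := exists_eq_conjDiagonal (show X.IsSymm from hX.isHermitian)
  have hl := posSemidef_conjDiagonal_iff.1 hX
  calc |conjDiagonal Q l i j| ≤ ∑ k, |l k| := abs_conjDiagonal_le Q l i j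
    _ = (conjDiagonal Q l).trace := by simp only [abs_of_nonneg (hl _), trace_conjDiagonal]

theorem transpose_mul_conjDiagonal_mul_apply_self (Q : orthogonalGroup ι ℝ) (l : ι → ℝ) (i : ι) :
    ((Q : Matrix ι ι ℝ)ᵀ * conjDiagonal Q l * Q) i i = l i := by
  rw [transpose_mul_conjDiagonal, Matrix.mul_assoc, transpose_mul_coe, mul_one, diagonal_apply_eq]

theorem tendsto_conjDiagonal {α : Type*} {L : Filter α} {Q : α → orthogonalGroup ι ℝ}
    {l : α → ι → ℝ} {P : orthogonalGroup ι ℝ} {μ : ι → ℝ} (hQ : Tendsto Q L (𝓝 P))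
    (hl : Tendsto l L (𝓝 μ)) :
    Tendsto (fun a => conjDiagonal (Q a) (l a)) L (𝓝 (conjDiagonal P μ)) := by
  have hcont : Continuous fun q : Matrix ι ι ℝ × (ι → ℝ) => q.1 * diagonal q.2 * q.1ᵀ := by
    fun_prop
  have hlim := (hcont.tendsto ((P : Matrix ι ι ℝ), μ)).comp
    ((tendsto_subtype_rng.1 hQ).prodMk_nhds hl)
  exact hlim

theorem isCompact_orthogonalGroup : IsCompact (orthogonalGroup ι ℝ : Set (Matrix ι ι ℝ)) := by
  have hbox : IsCompact
      {Q : Matrix ι ι ℝ | ∀ i ∈ Set.univ, Q i ∈ Set.univ.pi fun _ => Set.Icc (-1) 1} :=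
    isCompact_univ_pi fun _ => isCompact_univ_pi fun _ => isCompact_Icc
  exact hbox.of_isClosed_subset isClosed_unitary fun _ hQ i _ j _ =>
    abs_le.1 (entry_norm_bound_of_unitary hQ i j)

instance firstCountableTopology_matrix {κ ν : Type*} [Countable κ] [Countable ν] :
    FirstCountableTopology (Matrix κ ν ℝ) :=
  inferInstanceAs (FirstCountableTopology (κ → ν → ℝ))

theorem exists_subseq_tendsto_of_tendsto_conjDiagonal {Q : ℕ → orthogonalGroup ι ℝ}
    {l : ℕ → ι → ℝ} {A : Matrix ι ι ℝ}
    (hA : Tendsto (fun k => conjDiagonal (Q k) (l k)) atTop (𝓝 A)) :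
    ∃ (P : orthogonalGroup ι ℝ) (μ : ι → ℝ) (φ : ℕ → ℕ), StrictMono φ ∧
      Tendsto (Q ∘ φ) atTop (𝓝 P) ∧ Tendsto (l ∘ φ) atTop (𝓝 μ) ∧ A = conjDiagonal P μ := by
  obtain ⟨P, hPmem, φ, hφ, hP⟩ :=
    isCompact_orthogonalGroup.tendsto_subseq (x := fun k => (Q k : Matrix ι ι ℝ)) fun k => (Q k).2
  obtain ⟨P, rfl⟩ : ∃ P' : orthogonalGroup ι ℝ, (P' : Matrix ι ι ℝ) = P := ⟨⟨P, hPmem⟩, rfl⟩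
  have hAφ := hA.comp hφ.tendsto_atTop
  set μ : ι → ℝ := fun i => ((P : Matrix ι ι ℝ)ᵀ * A * P) i i
  have hl : Tendsto (l ∘ φ) atTop (𝓝 μ) := by
    refine tendsto_pi_nhds.2 fun i => ?_
    have hcont : Continuous fun q : Matrix ι ι ℝ × Matrix ι ι ℝ => (q.1ᵀ * q.2 * q.1) i i := by
      fun_prop
    exact ((hcont.tendsto (P, A)).comp (hP.prodMk_nhds hAφ)).congr fun k =>
      transpose_mul_conjDiagonal_mul_apply_self (Q (φ k)) (l (φ k)) i
  have hP' : Tendsto (Q ∘ φ) atTop (𝓝 P) := tendsto_subtype_rng.2 hP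
  exact ⟨P, μ, φ, hφ, hP', hl, tendsto_nhds_unique hAφ (tendsto_conjDiagonal hP' hl)⟩

theorem rank_eq_sub_finrank_ker {d : ℕ} (A : Matrix (Fin d) (Fin d) ℝ) :
    A.rank = d - Module.finrank ℝ (LinearMap.ker (toLin' A)) := by
  have hsum := LinearMap.finrank_range_add_finrank_ker (toLin' A)
  rw [Module.finrank_fin_fun] at hsum
  change Module.finrank ℝ (LinearMap.range (toLin' A)) = _
  lia

theorem eventually_forall_pos_of_posSemidef {d : ℕ} {A : Matrix (Fin d) (Fin d) ℝ}
    (hA : A.PosSemidef) :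
    ∀ᶠ X in 𝓝 A, ∀ (Q : orthogonalGroup (Fin d) ℝ) (μ : Fin d → ℝ), X = conjDiagonal Q μ →
      Antitone μ → ∀ j : Fin d, (j : ℕ) < A.rank → 0 < μ j := by
  by_contra hcon
  obtain ⟨X, hXA, hX⟩ := exists_seq_forall_of_frequently (not_eventually.1 hcon)
  push Not at hX
  choose Q μ hQμ hμ j hj hμj using hX
  obtain ⟨P, ν, φ, -, -, hν, rfl⟩ :=
    exists_subseq_tendsto_of_tendsto_conjDiagonal (hXA.congr hQμ)
  set r := (conjDiagonal P ν).rank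
  have hν_eq_zero (i : Fin d) (hi : r - 1 ≤ (i : ℕ)) : ν i = 0 := by
    refine le_antisymm (le_of_tendsto' (tendsto_pi_nhds.1 hν i) fun k => ?_)
      (posSemidef_conjDiagonal_iff.1 hA i)
    exact (hμ (φ k) (Fin.le_def.2 ((Nat.le_sub_one_of_lt (hj (φ k))).trans hi))).trans (hμj (φ k))
  have hlt (i : {i // ν i ≠ 0}) : (i.1 : ℕ) < r - 1 := by
    by_contra hi
    exact i.2 (hν_eq_zero i.1 (not_lt.1 hi))
  have hcard : r ≤ r - 1 := by
    have hinj := Fintype.card_le_of_injective (fun i => (⟨i.1, hlt i⟩ : Fin (r - 1)))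
      fun _ _ hab => Subtype.ext (Fin.ext (Fin.mk.inj hab))
    rwa [← rank_conjDiagonal P, Fintype.card_fin] at hinj
  have hr_pos := hj 0
  lia

end ConjDiagonal

/-! ### The Daleckii–Krein derivative -/

section DaleckiiKrein

open Matrix
open scoped Matrix.Norms.Elementwise

variable {ι : Type*} [Fintype ι]

theorem isLittleO_mul_mul_of_tendsto_zero {α : Type*} {L : Filter α} {A : α → Matrix ι ι ℝ}
    (hA : Tendsto A L (𝓝 0)) (H : α → Matrix ι ι ℝ) (E : Matrix ι ι ℝ) :
    (fun a => A a * H a * E) =o[L] H := by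
  have hAentry (i j : ι) : (fun a => A a i j) =o[L] fun _ => (1 : ℝ) :=
    (Asymptotics.isLittleO_one_iff ℝ).2 (tendsto_pi_nhds.1 (tendsto_pi_nhds.1 hA i) j)
  have hHentry (i j : ι) : (fun a => H a i j) =O[L] H :=
    .of_norm_right (.of_norm_le fun a => norm_entry_le_entrywise_sup_norm (H a))
  refine Asymptotics.isLittleO_pi.2 fun i => Asymptotics.isLittleO_pi.2 fun j => ?_
  simp only [Matrix.mul_apply, Finset.sum_mul]
  refine .fun_sum fun b _ => .fun_sum fun c _ => ?_
  simpa [mul_comm (E b j)] using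
    (((hAentry i c).mul_isBigO (hHentry c b).norm_right).const_mul_left (E b j)).norm_right

variable [DecidableEq ι]

theorem continuousWithinAt_cfc {g : ℝ → ℝ} {X : Matrix ι ι ℝ}
    (hg : ∀ t ∈ spectrum ℝ X, ContinuousAt g t) :
    ContinuousWithinAt (cfc g : Matrix ι ι ℝ → Matrix ι ι ℝ) {Y | Y.IsSymm} X := by
  refine tendsto_of_seq_tendsto fun Y hY => ?_
  obtain ⟨hYX, hYsymm⟩ := tendsto_nhdsWithin_iff.1 hY
  refine tendsto_of_subseq_tendsto fun φ hφ => ?_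
  have hdiag (k : ℕ) : ∃ (R : orthogonalGroup ι ℝ) (t : ι → ℝ),
      (Y (φ k)).IsSymm → Y (φ k) = conjDiagonal R t := by
    by_cases h : (Y (φ k)).IsSymm
    · exact (exists_eq_conjDiagonal h).imp fun R => .imp fun t ht _ => ht
    · exact ⟨1, 0, fun h' => (h h').elim⟩
  choose R t hRt using hdiag
  have hYφ : ∀ᶠ k in atTop, Y (φ k) = conjDiagonal (R k) (t k) :=
    (hφ.eventually hYsymm).mono fun k hk => hRt k hk
  obtain ⟨P, μ, ψ, hψ, hR, ht, rfl⟩ := exists_subseq_tendsto_of_tendsto_conjDiagonal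
    ((hYX.comp hφ).congr' hYφ)
  have hgt : Tendsto (fun k => g ∘ t (ψ k)) atTop (𝓝 (g ∘ μ)) := tendsto_pi_nhds.2 fun i =>
    (hg _ (spectrum_conjDiagonal P μ ▸ Set.mem_range_self i)).tendsto.comp (tendsto_pi_nhds.1 ht i)
  refine ⟨ψ, ?_⟩
  rw [cfc_conjDiagonal]
  refine (tendsto_conjDiagonal hR hgt).congr' ?_
  filter_upwards [hψ.tendsto_atTop.eventually hYφ] with k hk
  simp only [hk, cfc_conjDiagonal, Function.comp_apply]

/-- The Daleckii–Krein derivative of `X ↦ f(X)` at `X = Q diag(l) Qᵀ`: in the eigenbasis `Q`, the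
entry `H i j` of a direction is multiplied by the divided difference of `f` at `l i` and `l j`.
It is written columnwise here, as the sum over `j` of `g_j(X) H E_j`, where `g_j` is the divided
difference with `l j` and `E_j` projects onto the `j`-th eigenvector. -/
def daleckiiKrein (f : ℝ → ℝ) (Q : orthogonalGroup ι ℝ) (l : ι → ℝ) :
    Matrix ι ι ℝ →L[ℝ] Matrix ι ι ℝ :=
  LinearMap.toContinuousLinearMap <| ∑ j, LinearMap.mulLeftRight ℝ
    (conjDiagonal Q (dslope f (l j) ∘ l), conjDiagonal Q (Pi.single j 1))

theorem daleckiiKrein_apply (f : ℝ → ℝ) (Q : orthogonalGroup ι ℝ) (l : ι → ℝ) (H : Matrix ι ι ℝ) :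
    daleckiiKrein f Q l H =
      ∑ j, conjDiagonal Q (dslope f (l j) ∘ l) * H * conjDiagonal Q (Pi.single j 1) := by
  simp [daleckiiKrein]

theorem cfc_eq_add_cfc_dslope_mul {Y : Matrix ι ι ℝ} (hY : Y.IsSymm) (f : ℝ → ℝ) (a : ℝ) :
    cfc f Y = f a • 1 + cfc (dslope f a) Y * (Y - a • 1) := by
  obtain ⟨R, t, rfl⟩ := exists_eq_conjDiagonal hY
  have hft : f ∘ t = f a • 1 + (dslope f a ∘ t) * (t - a • 1) := by
    ext i
    have := sub_smul_dslope f a (t i)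
    simp only [smul_eq_mul] at this
    simp only [Function.comp_apply, Pi.add_apply, Pi.smul_apply, Pi.one_apply, Pi.mul_apply,
      Pi.sub_apply, smul_eq_mul]
    linarith
  simp only [cfc_conjDiagonal, hft, map_add, map_mul, map_sub, map_smul, map_one]

theorem cfc_sub_cfc_sub_daleckiiKrein (f : ℝ → ℝ) (Q : orthogonalGroup ι ℝ) (l : ι → ℝ)
    {Y : Matrix ι ι ℝ} (hY : Y.IsSymm) :
    cfc f Y - cfc f (conjDiagonal Q l) - daleckiiKrein f Q l (Y - conjDiagonal Q l) =
      ∑ j, (cfc (dslope f (l j)) Y - cfc (dslope f (l j)) (conjDiagonal Q l)) *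
        (Y - conjDiagonal Q l) * conjDiagonal Q (Pi.single j 1) := by
  have hsum : ∑ j, conjDiagonal Q (Pi.single j (1 : ℝ)) = 1 := by
    rw [← map_sum]
    exact (congrArg _ (Finset.univ_sum_single (1 : ι → ℝ))).trans (map_one _)
  have hcol (j : ι) : (cfc f Y - cfc f (conjDiagonal Q l)) * conjDiagonal Q (Pi.single j 1) =
      cfc (dslope f (l j)) Y * (Y - conjDiagonal Q l) * conjDiagonal Q (Pi.single j 1) := by
    have heigen (u : ι → ℝ) : conjDiagonal Q u * conjDiagonal Q (Pi.single j 1) =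
        u j • conjDiagonal Q (Pi.single j 1) := by
      rw [← map_mul, ← map_smul]
      congr 1
      ext i
      rcases eq_or_ne i j with rfl | hij <;> simp [*]
    rw [cfc_eq_add_cfc_dslope_mul hY f (l j), cfc_conjDiagonal, sub_mul, add_mul, heigen,
      mul_assoc _ (Y - conjDiagonal Q l), sub_mul Y, heigen, mul_assoc, sub_mul Y]
    simp
  calc _ = ∑ j, ((cfc f Y - cfc f (conjDiagonal Q l)) * conjDiagonal Q (Pi.single j 1) -
        conjDiagonal Q (dslope f (l j) ∘ l) * (Y - conjDiagonal Q l) *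
          conjDiagonal Q (Pi.single j 1)) := by
        rw [Finset.sum_sub_distrib, ← Finset.mul_sum, hsum, mul_one, daleckiiKrein_apply]
    _ = _ := Finset.sum_congr rfl fun j _ => by rw [hcol, cfc_conjDiagonal, ← sub_mul, ← sub_mul]

theorem hasFDerivWithinAt_cfc {f : ℝ → ℝ} {Q : orthogonalGroup ι ℝ} {l : ι → ℝ}
    (hf : ∀ i, DifferentiableAt ℝ f (l i)) :
    HasFDerivWithinAt (cfc f : Matrix ι ι ℝ → Matrix ι ι ℝ) (daleckiiKrein f Q l) {Y | Y.IsSymm}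
      (conjDiagonal Q l) := by
  refine .of_isLittleO ?_
  have hcont (j : ι) : ContinuousWithinAt (cfc (dslope f (l j)) : Matrix ι ι ℝ → Matrix ι ι ℝ)
      {Y | Y.IsSymm} (conjDiagonal Q l) := by
    refine continuousWithinAt_cfc fun t ht => ?_
    obtain ⟨i, rfl⟩ := (spectrum_conjDiagonal Q l).subset ht
    rcases eq_or_ne (l i) (l j) with hij | hij
    · exact hij ▸ continuousAt_dslope_same.2 (hf i)
    · exact (continuousAt_dslope_of_ne hij).2 (hf i).continuousAt
  have hsum := Asymptotics.IsLittleO.fun_sum (s := Finset.univ) fun j _ =>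
    isLittleO_mul_mul_of_tendsto_zero (tendsto_sub_nhds_zero_iff.2 (hcont j))
      (fun Y => Y - conjDiagonal Q l) (conjDiagonal Q (Pi.single j 1))
  refine hsum.congr' ?_ .rfl
  filter_upwards [self_mem_nhdsWithin] with Y hY
  exact (cfc_sub_cfc_sub_daleckiiKrein f Q l hY).symm

theorem trace_daleckiiKrein (f : ℝ → ℝ) (Q : orthogonalGroup ι ℝ) (l : ι → ℝ)
    (H : Matrix ι ι ℝ) :
    (daleckiiKrein f Q l H).trace = (conjDiagonal Q (deriv f ∘ l) * H).trace := by
  have hcol (j : ι) : (Pi.single j 1 : ι → ℝ) * (dslope f (l j) ∘ l) =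
      Pi.single j (deriv f (l j)) := by
    ext i
    rcases eq_or_ne i j with rfl | hij
    · simp
    · simp [hij]
  have hsum : deriv f ∘ l = ∑ j, Pi.single j (deriv f (l j)) :=
    (Finset.univ_sum_single (deriv f ∘ l)).symm
  rw [daleckiiKrein_apply, trace_sum, hsum, map_sum, Finset.sum_mul, trace_sum]
  refine Finset.sum_congr rfl fun j _ => ?_
  rw [trace_mul_comm, ← Matrix.mul_assoc, ← map_mul, hcol]

theorem trace_conjDiagonal_mul_mul_conjDiagonal_mul (Q : orthogonalGroup ι ℝ) (u v : ι → ℝ)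
    {H : Matrix ι ι ℝ} (hH : H.IsSymm) :
    (conjDiagonal Q u * H * conjDiagonal Q v * H).trace =
      ∑ i, ∑ j, u i * v j * ((Q : Matrix ι ι ℝ)ᵀ * H * Q) i j ^ 2 := by
  set M : Matrix ι ι ℝ := (Q : Matrix ι ι ℝ)ᵀ * H * Q with hM
  have hMsymm : M.IsSymm := by simp [hM, IsSymm, hH.eq, Matrix.mul_assoc]
  calc (conjDiagonal Q u * H * conjDiagonal Q v * H).trace
      = (diagonal u * M * (diagonal v * M)).trace := by
        rw [conjDiagonal_apply, conjDiagonal_apply]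
        simp only [hM, Matrix.mul_assoc]
        rw [trace_mul_comm]
        simp only [Matrix.mul_assoc]
    _ = ∑ i, ∑ j, (diagonal u * M) i j * (diagonal v * M) j i := by
        simp only [trace, diag_apply, Matrix.mul_apply']; rfl
    _ = ∑ i, ∑ j, u i * v j * M i j ^ 2 := by
        refine Finset.sum_congr rfl fun i _ => Finset.sum_congr rfl fun j _ => ?_
        rw [diagonal_mul, diagonal_mul, hMsymm.apply i j]
        ring

theorem trace_daleckiiKrein_mul (f : ℝ → ℝ) (Q : orthogonalGroup ι ℝ) (l : ι → ℝ)
    {H : Matrix ι ι ℝ} (hH : H.IsSymm) :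
    (daleckiiKrein f Q l H * H).trace =
      ∑ i, ∑ j, dslope f (l j) (l i) * ((Q : Matrix ι ι ℝ)ᵀ * H * Q) i j ^ 2 := by
  rw [daleckiiKrein_apply, Finset.sum_mul, trace_sum, Finset.sum_comm]
  refine Finset.sum_congr rfl fun j _ => ?_
  rw [trace_conjDiagonal_mul_mul_conjDiagonal_mul Q _ _ hH]
  simp [Pi.single_apply]

end DaleckiiKrein

/-! ### Powers of the positive part -/

section MatPos

open Matrix
open scoped Matrix.Norms.Elementwise

variable {d : ℕ}

theorem hasDerivAt_max_zero_pow (k : ℕ) (a : ℝ) :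
    HasDerivAt (fun s : ℝ => max s 0 ^ (k + 2)) ((k + 2) * max a 0 ^ (k + 1)) a := by
  rcases lt_trichotomy a 0 with ha | rfl | ha
  · have hzero : (fun s : ℝ => max s 0 ^ (k + 2)) =ᶠ[𝓝 a] fun _ => 0 := by
      filter_upwards [Iio_mem_nhds ha] with s hs
      simp [max_eq_right (Set.mem_Iio.1 hs).le]
    simpa [max_eq_right ha.le] using (hasDerivAt_const a (0 : ℝ)).congr_of_eventuallyEq hzero
  · have hpow : (fun s : ℝ => s ^ (k + 2)) =o[𝓝 0] fun s => s := by
      simpa using Asymptotics.isLittleO_pow_pow (𝕜 := ℝ) (m := 1) (n := k + 2) (by omega)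
    have habs (s : ℝ) : |max s 0| ≤ |s| := by
      rw [abs_of_nonneg (le_max_right s 0)]
      exact max_le (le_abs_self s) (abs_nonneg s)
    refine hasDerivAt_iff_isLittleO.2 ((Asymptotics.isBigO_of_le _ fun s => ?_).trans_isLittleO
      (hpow.congr_right fun s => (sub_zero s).symm))
    simpa [abs_pow] using pow_le_pow_left₀ (abs_nonneg _) (habs s) (k + 2)
  · have hpow : (fun s : ℝ => max s 0 ^ (k + 2)) =ᶠ[𝓝 a] fun s => s ^ (k + 2) := by
      filter_upwards [Ioi_mem_nhds ha] with s hs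
      rw [max_eq_left (Set.mem_Ioi.1 hs).le]
    simpa [max_eq_left ha.le] using (hasDerivAt_pow (k + 2) a).congr_of_eventuallyEq hpow

theorem matPos_conjDiagonal_pow (Q : orthogonalGroup (Fin d) ℝ) (l : Fin d → ℝ) (k : ℕ) :
    matPos (conjDiagonal Q l) ^ k = conjDiagonal Q fun i => max (l i) 0 ^ k := by
  rw [matPos, cfc_conjDiagonal, ← map_pow]
  rfl

theorem matPos_pow_eq_cfc {X : Matrix (Fin d) (Fin d) ℝ} (hX : X.IsSymm) (k : ℕ) :
    matPos X ^ k = cfc (fun t : ℝ => max t 0 ^ k) X := by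
  obtain ⟨Q, l, rfl⟩ := exists_eq_conjDiagonal hX
  rw [matPos_conjDiagonal_pow, cfc_conjDiagonal]
  rfl

theorem posSemidef_matPos_pow {X : Matrix (Fin d) (Fin d) ℝ} (hX : X.IsSymm) (k : ℕ) :
    (matPos X ^ k).PosSemidef := by
  obtain ⟨Q, l, rfl⟩ := exists_eq_conjDiagonal hX
  rw [matPos_conjDiagonal_pow, posSemidef_conjDiagonal_iff]
  exact fun i => pow_nonneg (le_max_right _ _) k

/-- The trace inner product as a continuous bilinear map. -/
def matInnerL : Matrix (Fin d) (Fin d) ℝ →L[ℝ] Matrix (Fin d) (Fin d) ℝ →L[ℝ] ℝ :=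
  LinearMap.toContinuousBilinearMap <| LinearMap.mk₂ ℝ matInner
    (fun _ _ _ => by simp [matInner, Matrix.add_mul]) (fun _ _ _ => by simp [matInner])
    (fun _ _ _ => by simp [matInner, Matrix.mul_add]) (fun _ _ _ => by simp [matInner])

theorem matInner_comm (V W : Matrix (Fin d) (Fin d) ℝ) : matInner V W = matInner W V := by
  rw [matInner, ← trace_transpose, transpose_mul, transpose_transpose, matInner]

theorem matInner_of_isSymm {V : Matrix (Fin d) (Fin d) ℝ} (hV : V.IsSymm)
    (W : Matrix (Fin d) (Fin d) ℝ) : matInner V W = (V * W).trace := by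
  rw [matInner, hV.eq]

theorem hasFDerivWithinAt_trace_cfc {f : ℝ → ℝ} {X : Matrix (Fin d) (Fin d) ℝ} (hX : X.IsSymm)
    (hf : ∀ t ∈ spectrum ℝ X, DifferentiableAt ℝ f t) :
    HasFDerivWithinAt (fun Y => (cfc f Y).trace) (matInnerL (cfc (deriv f) X)) {Y | Y.IsSymm}
      X := by
  obtain ⟨Q, l, rfl⟩ := exists_eq_conjDiagonal hX
  have htrace := (traceLinearMap (Fin d) ℝ ℝ).toContinuousLinearMap.hasFDerivAt
    |>.comp_hasFDerivWithinAt _ (hasFDerivWithinAt_cfc (Q := Q) fun i =>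
      hf _ ((spectrum_conjDiagonal Q l).superset ⟨i, rfl⟩))
  refine htrace.congr_fderiv (ContinuousLinearMap.ext fun H => ?_)
  have hinner : (conjDiagonal Q (deriv f ∘ l) * H).trace =
      matInner (cfc (deriv f) (conjDiagonal Q l)) H := by
    rw [cfc_conjDiagonal, matInner_of_isSymm (isSymm_conjDiagonal _ _)]
  exact (trace_daleckiiKrein f Q l H).trans hinner

theorem hasFDerivWithinAt_trace_matPos_pow {X : Matrix (Fin d) (Fin d) ℝ} (hX : X.IsSymm)
    (k : ℕ) :
    HasFDerivWithinAt (fun Y => (matPos Y ^ (k + 2)).trace)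
      ((k + 2 : ℝ) • matInnerL (matPos X ^ (k + 1))) {Y | Y.IsSymm} X := by
  have hderiv : deriv (fun s : ℝ => max s 0 ^ (k + 2)) = fun s => (k + 2 : ℝ) • max s 0 ^ (k + 1) :=
    funext fun s => (hasDerivAt_max_zero_pow k s).deriv
  have hcfc := hasFDerivWithinAt_trace_cfc hX fun t _ =>
    (hasDerivAt_max_zero_pow k t).differentiableAt
  refine (hcfc.congr_fderiv ?_).congr
    (fun Y hY => congrArg trace (matPos_pow_eq_cfc hY _)) (congrArg trace (matPos_pow_eq_cfc hX _))
  rw [hderiv, cfc_smul _ _ _ (finite_real_spectrum.continuousOn _), map_smul,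
    matPos_pow_eq_cfc hX]

end MatPos

/-! ### Derivatives of the penalty function and of the Lagrange function -/

section Derivatives

open Matrix
open scoped Matrix.Norms.Elementwise

variable {n m d : ℕ} (p : NSDP n m d)

theorem contDiff_matrix_G : ContDiff ℝ 2 p.G :=
  contDiff_pi.2 fun i => contDiff_pi.2 fun j => p.contDiff_G i j

theorem hasFDerivAt_f (x : EuclideanSpace ℝ (Fin n)) : HasFDerivAt p.f (fderiv ℝ p.f x) x :=
  (p.contDiff_f.differentiable (by norm_num) x).hasFDerivAt

theorem hasFDerivAt_g (x : EuclideanSpace ℝ (Fin n)) : HasFDerivAt p.g (fderiv ℝ p.g x) x :=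
  (p.contDiff_g.differentiable (by norm_num) x).hasFDerivAt

theorem hasFDerivAt_G (x : EuclideanSpace ℝ (Fin n)) : HasFDerivAt p.G (fderiv ℝ p.G x) x :=
  (p.contDiff_matrix_G.differentiable (by norm_num) x).hasFDerivAt

theorem fderiv_G_apply (x h : EuclideanSpace ℝ (Fin n)) : fderiv ℝ p.G x h = p.DG x h := by
  ext i j
  exact congrArg (· h)
    (hasFDerivAt_pi'.1 (hasFDerivAt_pi'.1 (p.hasFDerivAt_G x) i) j).fderiv.symm

theorem isSymm_neg_G (x : EuclideanSpace ℝ (Fin n)) : (-p.G x).IsSymm := (p.isSymm_G x).neg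

theorem isSymm_DG (x h : EuclideanSpace ℝ (Fin n)) : (p.DG x h).IsSymm := by
  ext i j
  have hG : (fun z => p.G z j i) = fun z => p.G z i j := funext fun z => (p.isSymm_G z).apply i j
  simp only [DG, transpose_apply, of_apply, hG]

theorem penalty_eq (γ : ℝ) (x : EuclideanSpace ℝ (Fin n)) :
    p.penalty γ x = p.f x + γ * p.infeasibility x := by
  rw [penalty, infeasibility]
  ring

theorem hasFDerivAt_infeasibility (x : EuclideanSpace ℝ (Fin n)) :
    HasFDerivAt p.infeasibility ((innerSL ℝ (p.g x)).comp (fderiv ℝ p.g x) -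
      (matInnerL (matPos (-p.G x) ^ 3)).comp (fderiv ℝ p.G x)) x := by
  have htrace := (hasFDerivWithinAt_trace_matPos_pow (p.isSymm_neg_G x) 2).comp_hasFDerivAt x
    (p.hasFDerivAt_G x).neg (Eventually.of_forall p.isSymm_neg_G)
  refine (((p.hasFDerivAt_g x).norm_sq.const_mul (1 / 2)).add
    (htrace.const_mul (1 / 4))).congr_fderiv (ContinuousLinearMap.ext fun h => ?_)
  have hvalue : 1 / 2 * (2 • inner ℝ (p.g x) (fderiv ℝ p.g x h)) +
      1 / 4 * (((2 : ℕ) + 2) * matInner (matPos (-p.G x) ^ 3) (-fderiv ℝ p.G x h)) =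
      inner ℝ (p.g x) (fderiv ℝ p.g x h) -
        matInner (matPos (-p.G x) ^ 3) (fderiv ℝ p.G x h) := by
    rw [matInner, mul_neg, trace_neg, ← matInner, nsmul_eq_mul]
    push_cast
    ring
  exact hvalue

/-- The multiplier `y_k = -γ g(x_k)` of the equality constraints. -/
def eqMultiplier (γ : ℝ) (x : EuclideanSpace ℝ (Fin n)) : EuclideanSpace ℝ (Fin m) :=
  -(γ • p.g x)

/-- The multiplier `Z_k = γ [-G(x_k)]₊³` of the semidefinite constraint. -/
def psdMultiplier (γ : ℝ) (x : EuclideanSpace ℝ (Fin n)) : Matrix (Fin d) (Fin d) ℝ :=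
  γ • matPos (-p.G x) ^ 3

theorem contDiff_lagrangian (y : EuclideanSpace ℝ (Fin m)) (Z : Matrix (Fin d) (Fin d) ℝ) :
    ContDiff ℝ 2 fun x => p.lagrangian x y Z :=
  (p.contDiff_f.sub (p.contDiff_g.inner ℝ contDiff_const)).sub
    ((matInnerL.flip Z).contDiff.comp p.contDiff_matrix_G)

theorem fderiv_lagrangian (y : EuclideanSpace ℝ (Fin m)) (Z : Matrix (Fin d) (Fin d) ℝ)
    (x : EuclideanSpace ℝ (Fin n)) :
    fderiv ℝ (fun z => p.lagrangian z y Z) x = fderiv ℝ p.f x -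
      (innerSL ℝ y).comp (fderiv ℝ p.g x) - (matInnerL Z).comp (fderiv ℝ p.G x) := by
  have hL : (fun z => p.lagrangian z y Z) =
      fun z => p.f z - innerSL ℝ y (p.g z) - matInnerL Z (p.G z) := by
    funext z
    rw [lagrangian, real_inner_comm, matInner_comm]
    rfl
  rw [hL]
  exact (((p.hasFDerivAt_f x).sub ((innerSL ℝ y).hasFDerivAt.comp x (p.hasFDerivAt_g x))).sub
    ((matInnerL Z).hasFDerivAt.comp x (p.hasFDerivAt_G x))).fderiv

theorem fderiv_penalty (γ : ℝ) (x : EuclideanSpace ℝ (Fin n)) :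
    fderiv ℝ (p.penalty γ) x = fderiv ℝ p.f x + γ • fderiv ℝ p.infeasibility x := by
  rw [funext (p.penalty_eq γ)]
  exact ((p.hasFDerivAt_f x).add
    ((p.hasFDerivAt_infeasibility x).differentiableAt.hasFDerivAt.const_mul γ)).fderiv

theorem gradient_penalty (γ : ℝ) (x : EuclideanSpace ℝ (Fin n)) :
    gradient (p.penalty γ) x = gradient p.f x + γ • gradient p.infeasibility x := by
  simp only [gradient, fderiv_penalty, map_add, map_smulₛₗ, RCLike.conj_to_real]

theorem fderiv_penalty_sub_fderiv_lagrangian (γ : ℝ) (x z : EuclideanSpace ℝ (Fin n)) :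
    fderiv ℝ (p.penalty γ) z -
        fderiv ℝ (fun w => p.lagrangian w (p.eqMultiplier γ x) (p.psdMultiplier γ x)) z =
      γ • ((innerSL ℝ (p.g z - p.g x)).comp (fderiv ℝ p.g z) -
        (matInnerL (matPos (-p.G z) ^ 3 - matPos (-p.G x) ^ 3)).comp (fderiv ℝ p.G z)) := by
  rw [fderiv_penalty, (p.hasFDerivAt_infeasibility z).fderiv, fderiv_lagrangian, eqMultiplier,
    psdMultiplier]
  simp only [map_neg, map_sub, map_smul, ContinuousLinearMap.sub_comp,
    ContinuousLinearMap.neg_comp, ContinuousLinearMap.smul_comp]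
  module

theorem gradient_lagrangian (γ : ℝ) (x : EuclideanSpace ℝ (Fin n)) :
    gradient (fun z => p.lagrangian z (p.eqMultiplier γ x) (p.psdMultiplier γ x)) x =
      gradient (p.penalty γ) x := by
  have hsub := p.fderiv_penalty_sub_fderiv_lagrangian γ x x
  simp only [sub_self, map_zero, ContinuousLinearMap.zero_comp, smul_zero] at hsub
  rw [gradient, gradient, sub_eq_zero.1 hsub]

end Derivatives

/-! ### Hessians -/

section Hessians

open Matrix
open scoped Matrix.Norms.Elementwise

theorem sum_apply_smul_single {n : ℕ} (h : EuclideanSpace ℝ (Fin n)) :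
    ∑ i, h i • EuclideanSpace.single i (1 : ℝ) = h := by
  simpa using (EuclideanSpace.basisFun (Fin n) ℝ).sum_repr h

theorem dotProduct_hessian_mulVec {n : ℕ} (φ : EuclideanSpace ℝ (Fin n) → ℝ)
    (x h : EuclideanSpace ℝ (Fin n)) :
    h.ofLp ⬝ᵥ (hessian φ x *ᵥ h.ofLp) = fderiv ℝ (fderiv ℝ φ) x h h := by
  conv_rhs => rw [← sum_apply_smul_single h]
  simp only [map_sum, map_smul, _root_.sum_apply, _root_.smul_apply, smul_eq_mul, dotProduct,
    mulVec, hessian, of_apply, Finset.mul_sum]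
  rw [Finset.sum_comm]
  exact Finset.sum_congr rfl fun i _ => Finset.sum_congr rfl fun j _ => by ring

theorem hasFDerivAt_bilinear_comp_of_eq_zero {E F V : Type*} [NormedAddCommGroup E]
    [NormedSpace ℝ E] [NormedAddCommGroup F] [NormedSpace ℝ F] [NormedAddCommGroup V]
    [NormedSpace ℝ V] (B : F →L[ℝ] V →L[ℝ] ℝ) {u : E → F} {u' : E →L[ℝ] F} {D : E → E →L[ℝ] V}
    {x : E} (hu : HasFDerivAt u u' x) (hD : DifferentiableAt ℝ D x) (hux : u x = 0) :
    HasFDerivAt (fun z => (B (u z)).comp (D z))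
      (((ContinuousLinearMap.compL ℝ E V ℝ).flip (D x)).comp (B.comp u')) x := by
  refine ((B.hasFDerivAt.comp x hu).clm_comp hD.hasFDerivAt).congr_fderiv ?_
  ext v w
  simp [hux]

variable {n m d : ℕ} (p : NSDP n m d)

theorem hasFDerivAt_matPos_neg_G_pow {x : EuclideanSpace ℝ (Fin n)}
    {Q : orthogonalGroup (Fin d) ℝ} {l : Fin d → ℝ} (hx : -p.G x = conjDiagonal Q l) (k : ℕ) :
    HasFDerivAt (fun z => matPos (-p.G z) ^ (k + 2))
      ((daleckiiKrein (fun s => max s 0 ^ (k + 2)) Q l).comp (-fderiv ℝ p.G x)) x := by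
  have hcfc := hasFDerivWithinAt_cfc (Q := Q) fun i =>
    (hasDerivAt_max_zero_pow k (l i)).differentiableAt
  rw [← hx] at hcfc
  have hcomp := hcfc.comp_hasFDerivAt x (p.hasFDerivAt_G x).neg
    (Eventually.of_forall p.isSymm_neg_G)
  exact hcomp.congr_of_eventuallyEq
    (Eventually.of_forall fun z => matPos_pow_eq_cfc (p.isSymm_neg_G z) _)

theorem dotProduct_hessian_penalty (γ : ℝ) {x : EuclideanSpace ℝ (Fin n)}
    {Q : orthogonalGroup (Fin d) ℝ} {l : Fin d → ℝ} (hx : -p.G x = conjDiagonal Q l)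
    (h : EuclideanSpace ℝ (Fin n)) :
    h.ofLp ⬝ᵥ (hessian (p.penalty γ) x *ᵥ h.ofLp) =
      h.ofLp ⬝ᵥ (hessian (fun z => p.lagrangian z (p.eqMultiplier γ x) (p.psdMultiplier γ x)) x *ᵥ
        h.ofLp) + γ * (‖fderiv ℝ p.g x h‖ ^ 2 +
        (daleckiiKrein (fun s => max s 0 ^ 3) Q l (p.DG x h) * p.DG x h).trace) := by
  have hfderiv : fderiv ℝ (p.penalty γ) = fun z =>
      fderiv ℝ (fun w => p.lagrangian w (p.eqMultiplier γ x) (p.psdMultiplier γ x)) z +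
        γ • ((innerSL ℝ (p.g z - p.g x)).comp (fderiv ℝ p.g z) -
        (matInnerL (matPos (-p.G z) ^ 3 - matPos (-p.G x) ^ 3)).comp (fderiv ℝ p.G z)) :=
    funext fun z => by rw [← p.fderiv_penalty_sub_fderiv_lagrangian, add_sub_cancel]
  have hLagr := (((p.contDiff_lagrangian (p.eqMultiplier γ x) (p.psdMultiplier γ x)).fderiv_right
    (m := 1) (by norm_num)).differentiable (by norm_num) x).hasFDerivAt
  have hDg : DifferentiableAt ℝ (fderiv ℝ p.g) x :=
    (p.contDiff_g.fderiv_right (m := 1) (by norm_num)).differentiable (by norm_num) x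
  have hDG : DifferentiableAt ℝ (fderiv ℝ p.G) x :=
    (p.contDiff_matrix_G.fderiv_right (m := 1) (by norm_num)).differentiable (by norm_num) x
  have hg := hasFDerivAt_bilinear_comp_of_eq_zero (innerSL ℝ)
    ((p.hasFDerivAt_g x).sub_const (p.g x)) hDg (sub_self _)
  have hG := hasFDerivAt_bilinear_comp_of_eq_zero matInnerL
    ((p.hasFDerivAt_matPos_neg_G_pow hx 1).sub_const (matPos (-p.G x) ^ 3)) hDG (sub_self _)
  have hsecond := (hLagr.add ((hg.sub hG).const_smul γ)).fderiv
  have hvalue : inner ℝ (fderiv ℝ p.g x h) (fderiv ℝ p.g x h) -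
      matInner (daleckiiKrein (fun s => max s 0 ^ 3) Q l (-fderiv ℝ p.G x h)) (fderiv ℝ p.G x h) =
      ‖fderiv ℝ p.g x h‖ ^ 2 +
        (daleckiiKrein (fun s => max s 0 ^ 3) Q l (p.DG x h) * p.DG x h).trace := by
    rw [real_inner_self_eq_norm_sq, map_neg, matInner_comm, fderiv_G_apply, matInner,
      (p.isSymm_DG x h).eq, mul_neg, trace_neg, sub_neg_eq_add, trace_mul_comm]
  rw [dotProduct_hessian_mulVec, dotProduct_hessian_mulVec, ← hvalue, hfderiv]
  exact congrArg (fun A => A h h) hsecond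

end Hessians

/-! ### The curvature term -/

section Curvature

open Matrix

theorem dslope_comm (f : ℝ → ℝ) (a b : ℝ) : dslope f a b = dslope f b a := by
  rcases eq_or_ne a b with rfl | hab
  · rfl
  · rw [dslope_of_ne f hab, dslope_of_ne f hab.symm, slope_comm]

theorem dslope_max_zero_pow_neg_le (k : ℕ) {a : ℝ} (ha : 0 < a) (b : ℝ) :
    dslope (fun s => max s 0 ^ (k + 2)) (-a) (-b) ≤ max (-b) 0 ^ (k + 2) * a⁻¹ := by
  have ha' : max (-a) 0 = 0 := max_eq_right (neg_nonpos.2 ha.le)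
  rcases eq_or_ne (-b) (-a) with hba | hba
  · rw [hba, dslope_same, (hasDerivAt_max_zero_pow k (-a)).deriv, ha']
    simp
  rw [dslope_of_ne _ hba, slope_def_field, ha', zero_pow (by lia), sub_zero]
  rcases le_total 0 b with hb | hb
  · simp [max_eq_right (neg_nonpos.2 hb)]
  · rw [div_eq_mul_inv]
    gcongr
    linarith

variable {ι : Type*} [Fintype ι]

theorem transpose_mul_mul_apply_eq_zero {κ ν R : Type*} [Finite κ] [CommRing R]
    {U : Matrix ι κ R} {Q : Matrix ι ν R} {H : Matrix ι ι R} {s : Set ν}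
    (hspan : Submodule.span R (Q.col '' s) ≤ Submodule.span R (Set.range U.col))
    (hU : Uᵀ * H * U = 0) {i j : ν} (hi : i ∈ s) (hj : j ∈ s) : (Qᵀ * H * Q) i j = 0 := by
  cases nonempty_fintype κ
  have hcol {b : ν} (hb : b ∈ s) : ∃ c : κ → R, U *ᵥ c = Q.col b := by
    have hmem := hspan (Submodule.subset_span (Set.mem_image_of_mem Q.col hb))
    rwa [← range_mulVecLin] at hmem
  obtain ⟨a, ha⟩ := hcol hi
  obtain ⟨b, hb⟩ := hcol hj
  calc (Qᵀ * H * Q) i j = Q.col i ⬝ᵥ H *ᵥ Q.col j := by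
        rw [Matrix.mul_assoc, mul_apply]
        rfl
    _ = a ⬝ᵥ (Uᵀ * H * U) *ᵥ b := by
        rw [← ha, ← hb, Matrix.mul_assoc, ← mulVec_mulVec, ← mulVec_mulVec, dotProduct_mulVec a,
          vecMul_transpose]
    _ = 0 := by rw [hU, zero_mulVec, dotProduct_zero]

theorem trace_daleckiiKrein_mul_le {d k : ℕ} {Q : orthogonalGroup (Fin d) ℝ} {μ : Fin d → ℝ}
    {H : Matrix (Fin d) (Fin d) ℝ} {s : Set (Fin d)} (hH : H.IsSymm) (hpos : ∀ i ∉ s, 0 < μ i)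
    (hzero : ∀ i ∈ s, ∀ j ∈ s, ((Q : Matrix (Fin d) (Fin d) ℝ)ᵀ * H * Q) i j = 0) :
    (daleckiiKrein (fun t => max t 0 ^ (k + 2)) Q (-μ) H * H).trace ≤
      2 * matInner (matPos (-conjDiagonal Q μ) ^ (k + 2)) (H * pinv (conjDiagonal Q μ) * H) := by
  set K := (Q : Matrix (Fin d) (Fin d) ℝ)ᵀ * H * Q with hK
  have hKsymm (i j) : K i j = K j i := by
    have : K.IsSymm := by simp [hK, IsSymm, hH.eq, Matrix.mul_assoc]
    exact this.apply j i
  set u : Fin d → ℝ := fun i => max (-μ i) 0 ^ (k + 2) with hu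
  have hu0 {i} (hi : 0 < μ i) : u i = 0 := by simp [hu, max_eq_right (neg_nonpos.2 hi.le)]
  have hRHS : matInner (matPos (-conjDiagonal Q μ) ^ (k + 2)) (H * pinv (conjDiagonal Q μ) * H) =
      ∑ i, ∑ j, u i * (μ j)⁻¹ * K i j ^ 2 := by
    rw [← map_neg, matPos_conjDiagonal_pow, matInner_of_isSymm (isSymm_conjDiagonal Q _), pinv,
      cfc_conjDiagonal, ← Matrix.mul_assoc, ← Matrix.mul_assoc,
      trace_conjDiagonal_mul_mul_conjDiagonal_mul Q _ _ hH]
    rfl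
  rw [trace_daleckiiKrein_mul _ Q _ hH, hRHS, two_mul]
  conv_rhs => arg 2; rw [Finset.sum_comm]
  simp only [← Finset.sum_add_distrib]
  refine Finset.sum_le_sum fun i _ => Finset.sum_le_sum fun j _ => ?_
  rw [← hK, hKsymm j i, ← add_mul]
  by_cases hij : i ∈ s ∧ j ∈ s
  · simp [hzero i hij.1 j hij.2]
  refine mul_le_mul_of_nonneg_right ?_ (sq_nonneg _)
  rcases not_and_or.1 hij with hi | hj
  · rw [hu0 (hpos i hi), zero_mul, zero_add, dslope_comm]
    exact dslope_max_zero_pow_neg_le k (hpos i hi) (μ j)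
  · rw [hu0 (hpos j hj), zero_mul, add_zero]
    exact dslope_max_zero_pow_neg_le k (hpos j hj) (μ i)

variable {n m d : ℕ} (p : NSDP n m d)

theorem DG_eq_sum_partialG (x h : EuclideanSpace ℝ (Fin n)) :
    p.DG x h = ∑ i, h i • p.partialG i x := by
  ext a b
  simp only [partialG, DG, of_apply, Matrix.sum_apply, Matrix.smul_apply]
  conv_lhs => rw [← sum_apply_smul_single h]
  simp only [map_sum, map_smul]

theorem dotProduct_sigmaTerm_mulVec (x h : EuclideanSpace ℝ (Fin n))
    (Z : Matrix (Fin d) (Fin d) ℝ) :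
    h.ofLp ⬝ᵥ p.sigmaTerm x Z *ᵥ h.ofLp =
      2 * matInner Z (p.DG x h * pinv (p.G x) * p.DG x h) := by
  rw [DG_eq_sum_partialG, matInner]
  simp only [Finset.sum_mul, Finset.mul_sum, Matrix.smul_mul, Matrix.mul_smul, trace_sum,
    trace_smul, smul_eq_mul, dotProduct, mulVec, sigmaTerm, of_apply, matInner]
  rw [Finset.sum_comm]
  exact Finset.sum_congr rfl fun i _ => Finset.sum_congr rfl fun j _ => by ring

theorem neg_mul_norm_sq_le_hessian_lagrangian_add_sigmaTerm {γ δ : ℝ} (hγ : 0 ≤ γ)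
    {xbar x : EuclideanSpace ℝ (Fin n)}
    (hgap : ∀ Q μ, p.G x = conjDiagonal Q μ → Antitone μ → ∀ j : Fin d,
      (j : ℕ) < (p.G xbar).rank → 0 < μ j)
    (hpsd : (hessian (p.penalty γ) x + δ • (1 : Matrix (Fin n) (Fin n) ℝ)).PosSemidef)
    {h : EuclideanSpace ℝ (Fin n)} (hh : h ∈ p.perturbedCriticalSubspace xbar x) :
    -δ * ‖h‖ ^ 2 ≤ h.ofLp ⬝ᵥ
      ((hessian (fun z => p.lagrangian z (p.eqMultiplier γ x) (p.psdMultiplier γ x)) x +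
        p.sigmaTerm x (p.psdMultiplier γ x)) *ᵥ h.ofLp) := by
  obtain ⟨hg, U, ⟨-, Q, μ, hQ, hμ, hQμ, hspan⟩, hU⟩ := hh
  lift Q to orthogonalGroup (Fin d) ℝ using hQ
  change p.G x = conjDiagonal Q μ at hQμ
  have hcurv := trace_daleckiiKrein_mul_le (k := 1) (p.isSymm_DG x h)
    (fun i hi => hgap Q μ hQμ hμ i (rank_eq_sub_finrank_ker (p.G xbar) ▸ not_le.1 hi))
    (fun i hi j hj => transpose_mul_mul_apply_eq_zero hspan.ge hU hi hj)
  have hhess := p.dotProduct_hessian_penalty γ (by rw [hQμ, map_neg]) h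
  have hnorm : h.ofLp ⬝ᵥ h.ofLp = ‖h‖ ^ 2 := by
    rw [EuclideanSpace.real_norm_sq_eq]
    simp only [dotProduct, sq]
  have hnonneg : 0 ≤ h.ofLp ⬝ᵥ (hessian (p.penalty γ) x *ᵥ h.ofLp) + δ * ‖h‖ ^ 2 := by
    simpa [add_mulVec, smul_mulVec, hnorm] using hpsd.dotProduct_mulVec_nonneg h.ofLp
  have hZ : matInner (p.psdMultiplier γ x) (p.DG x h * pinv (p.G x) * p.DG x h) =
      γ * matInner (matPos (-p.G x) ^ 3) (p.DG x h * pinv (p.G x) * p.DG x h) := by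
    simp [psdMultiplier, matInner]
  rw [hhess, hg, norm_zero] at hnonneg
  rw [add_mulVec, dotProduct_add, dotProduct_sigmaTerm_mulVec, hZ, hQμ]
  linarith [mul_le_mul_of_nonneg_left hcurv hγ]

end Curvature

/-! ### The infeasibility measure -/

section Infeasibility

open Matrix

theorem trace_matPos_neg_pow_eq_zero_iff {d : ℕ} {X : Matrix (Fin d) (Fin d) ℝ} (hX : X.IsSymm)
    (k : ℕ) : (matPos (-X) ^ (k + 1)).trace = 0 ↔ X.PosSemidef := by
  obtain ⟨Q, μ, rfl⟩ := exists_eq_conjDiagonal hX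
  rw [← map_neg, matPos_conjDiagonal_pow, trace_conjDiagonal, posSemidef_conjDiagonal_iff,
    Finset.sum_eq_zero_iff_of_nonneg fun i _ => pow_nonneg (le_max_right _ _) _]
  simp

theorem trace_pow_four_le_frobNorm_pow_four {d : ℕ} {X : Matrix (Fin d) (Fin d) ℝ}
    (hX : X.IsSymm) : (X ^ 4).trace ≤ frobNorm X ^ 4 := by
  obtain ⟨Q, l, rfl⟩ := exists_eq_conjDiagonal hX
  have hnorm : frobNorm (conjDiagonal Q l) ^ 2 = ∑ i, l i ^ 2 := by
    rw [frobNorm, matInner_of_isSymm hX, ← map_mul, trace_conjDiagonal]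
    simp only [Pi.mul_apply, ← sq]
    exact Real.sq_sqrt (Finset.sum_nonneg fun i _ => sq_nonneg (l i))
  calc (conjDiagonal Q l ^ 4).trace = ∑ i, (l i ^ 2) ^ 2 := by
        rw [← map_pow, trace_conjDiagonal]
        simp only [Pi.pow_apply, ← pow_mul]
    _ ≤ (∑ i, l i ^ 2) ^ 2 := Finset.sum_sq_le_sq_sum_of_nonneg fun i _ => sq_nonneg (l i)
    _ = frobNorm (conjDiagonal Q l) ^ 4 := by rw [← hnorm, ← pow_mul]

theorem symProd_matPos_neg_pow {d : ℕ} {X : Matrix (Fin d) (Fin d) ℝ} (hX : X.IsSymm) (k : ℕ) :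
    symProd X (matPos (-X) ^ (k + 1)) = -matPos (-X) ^ (k + 2) := by
  obtain ⟨Q, μ, rfl⟩ := exists_eq_conjDiagonal hX
  simp only [symProd, ← map_neg, matPos_conjDiagonal_pow, ← map_mul, ← map_add, ← map_smul]
  congr 1
  ext i
  rcases le_total (μ i) 0 with hi | hi
  · simp only [one_div, Pi.neg_apply, Pi.smul_apply, Pi.add_apply, Pi.mul_apply,
      max_eq_left (neg_nonneg.2 hi), smul_eq_mul]
    ring
  · simp [max_eq_right (neg_nonpos.2 hi)]

variable {n m d : ℕ} (p : NSDP n m d)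

theorem infeasibility_nonneg (x : EuclideanSpace ℝ (Fin n)) : 0 ≤ p.infeasibility x := by
  have htrace := (posSemidef_matPos_pow (p.isSymm_neg_G x) 4).trace_nonneg
  rw [infeasibility]
  positivity

theorem infeasibility_eq_zero_iff {x : EuclideanSpace ℝ (Fin n)} :
    p.infeasibility x = 0 ↔ p.Feasible x := by
  have htrace := (posSemidef_matPos_pow (p.isSymm_neg_G x) 4).trace_nonneg
  rw [infeasibility, add_eq_zero_iff_of_nonneg (by positivity) (by positivity), Feasible,
    ← trace_matPos_neg_pow_eq_zero_iff (p.isSymm_G x) 3]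
  simp

theorem violation_nonneg (x : EuclideanSpace ℝ (Fin n)) : 0 ≤ p.violation x :=
  (norm_nonneg _).trans (le_max_left _ _)

theorem infeasibility_le (x : EuclideanSpace ℝ (Fin n)) :
    p.infeasibility x ≤ 1 / 2 * p.violation x ^ 2 + 1 / 4 * p.violation x ^ 4 := by
  have hsymm : (matPos (-p.G x)).IsSymm := by
    simpa using (posSemidef_matPos_pow (p.isSymm_neg_G x) 1).isHermitian
  have htrace : (matPos (-p.G x) ^ 4).trace ≤ p.violation x ^ 4 :=
    (trace_pow_four_le_frobNorm_pow_four hsymm).trans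
      (pow_le_pow_left₀ (Real.sqrt_nonneg _) (le_max_right _ _) 4)
  have hnorm : ‖p.g x‖ ≤ p.violation x := le_max_left _ _
  rw [infeasibility]
  gcongr

theorem continuous_infeasibility : Continuous p.infeasibility :=
  continuous_iff_continuousAt.2 fun x => (p.hasFDerivAt_infeasibility x).continuousAt

end Infeasibility

/-! ### Sequential optimality of approximate stationary points of the penalty functions -/

section PenaltySeq

open Matrix

variable {n m d : ℕ} {p : NSDP n m d} {xbar : EuclideanSpace ℝ (Fin n)} {γ ε : ℕ → ℝ}
  {x : ℕ → EuclideanSpace ℝ (Fin n)} {y : ℕ → EuclideanSpace ℝ (Fin m)}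
  {Z : ℕ → Matrix (Fin d) (Fin d) ℝ}

/-- `x k → xbar` are approximate second-order stationary points of the penalty functions with
parameters `γ k`, the Hessians being positive semidefinite up to `ε k`, and `y k`, `Z k` are the
multipliers that belong to them. -/
structure IsPenaltySeq (p : NSDP n m d) (xbar : EuclideanSpace ℝ (Fin n)) (γ : ℕ → ℝ)
    (x : ℕ → EuclideanSpace ℝ (Fin n)) (y : ℕ → EuclideanSpace ℝ (Fin m))
    (Z : ℕ → Matrix (Fin d) (Fin d) ℝ) (ε : ℕ → ℝ) : Prop where
  tendsto : Tendsto x atTop (𝓝 xbar)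
  gamma_nonneg : ∀ k, 0 ≤ γ k
  eps_pos : ∀ k, 0 < ε k
  eps_tendsto : Tendsto ε atTop (𝓝 0)
  gradient_tendsto : Tendsto (fun k => gradient (p.penalty (γ k)) (x k)) atTop (𝓝 0)
  hessian_posSemidef : ∀ k,
    (hessian (p.penalty (γ k)) (x k) + ε k • (1 : Matrix (Fin n) (Fin n) ℝ)).PosSemidef
  y_eq : ∀ k, y k = p.eqMultiplier (γ k) (x k)
  Z_eq : ∀ k, Z k = p.psdMultiplier (γ k) (x k)

namespace IsPenaltySeq

theorem comp (h : p.IsPenaltySeq xbar γ x y Z ε) {ψ : ℕ → ℕ} (hψ : StrictMono ψ) :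
    p.IsPenaltySeq xbar (γ ∘ ψ) (x ∘ ψ) (y ∘ ψ) (Z ∘ ψ) (ε ∘ ψ) where
  tendsto := h.tendsto.comp hψ.tendsto_atTop
  gamma_nonneg k := h.gamma_nonneg (ψ k)
  eps_pos k := h.eps_pos (ψ k)
  eps_tendsto := h.eps_tendsto.comp hψ.tendsto_atTop
  gradient_tendsto := h.gradient_tendsto.comp hψ.tendsto_atTop
  hessian_posSemidef k := h.hessian_posSemidef (ψ k)
  y_eq k := h.y_eq (ψ k)
  Z_eq k := h.Z_eq (ψ k)

theorem posSemidef_Z (h : p.IsPenaltySeq xbar γ x y Z ε) (k : ℕ) : (Z k).PosSemidef :=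
  h.Z_eq k ▸ (posSemidef_matPos_pow (p.isSymm_neg_G (x k)) 3).smul (h.gamma_nonneg k)

theorem tendsto_G (h : p.IsPenaltySeq xbar γ x y Z ε) :
    Tendsto (fun k => p.G (x k)) atTop (𝓝 (p.G xbar)) :=
  ((continuous_matrix fun i j => (p.contDiff_G i j).continuous).tendsto xbar).comp h.tendsto

theorem tendsto_gradient_lagrangian (h : p.IsPenaltySeq xbar γ x y Z ε) :
    Tendsto (fun k => gradient (fun z => p.lagrangian z (y k) (Z k)) (x k)) atTop (𝓝 0) :=
  h.gradient_tendsto.congr fun k => by rw [h.y_eq, h.Z_eq, gradient_lagrangian]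

theorem secondOrderSeq (h : p.IsPenaltySeq xbar γ x y Z ε) (hxbar : (p.G xbar).PosSemidef) :
    p.SecondOrderSeq xbar x y Z ε := by
  obtain ⟨N, hgap⟩ := eventually_atTop.1
    (h.tendsto_G.eventually (eventually_forall_pos_of_posSemidef hxbar))
  refine ⟨h.eps_pos, h.eps_tendsto, N, fun k hk v hv => ?_⟩
  rw [h.y_eq, h.Z_eq]
  exact p.neg_mul_norm_sq_le_hessian_lagrangian_add_sigmaTerm (h.gamma_nonneg k) (hgap k hk)
    (h.hessian_posSemidef k) hv

theorem exists_isAKKT2Seq (h : p.IsPenaltySeq xbar γ x y Z ε) (hxbar : (p.G xbar).PosSemidef) :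
    ∃ ψ : ℕ → ℕ, StrictMono ψ ∧ p.IsAKKT2Seq xbar (x ∘ ψ) (y ∘ ψ) (Z ∘ ψ) (ε ∘ ψ) := by
  choose Q μ hQ using fun k => exists_eq_conjDiagonal (p.isSymm_G (x k))
  obtain ⟨P, ν, ψ, hψ, hP, hν, hPν⟩ :=
    exists_subseq_tendsto_of_tendsto_conjDiagonal (h.tendsto_G.congr hQ)
  have hψ' := h.comp hψ
  have hZ (k : ℕ) : Z k = conjDiagonal (Q k) (γ k • fun i => max (-μ k i) 0 ^ 3) := by
    rw [h.Z_eq, psdMultiplier, hQ, ← map_neg, matPos_conjDiagonal_pow, map_smul]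
    rfl
  refine ⟨ψ, hψ, ⟨hψ'.posSemidef_Z, hψ'.tendsto, hψ'.tendsto_gradient_lagrangian, P,
    fun k => Q (ψ k), ν, fun k => γ (ψ k) • fun i => max (-μ (ψ k) i) 0 ^ 3, P.2,
    fun k => (Q (ψ k)).2, tendsto_subtype_rng.1 hP, hPν, fun k => hZ (ψ k), fun j hj => ?_⟩,
    hψ'.secondOrderSeq hxbar⟩
  refine eventually_atTop.1 (((tendsto_pi_nhds.1 hν j).eventually_const_lt hj).mono fun k hk => ?_)
  have hμ : max (-μ (ψ k) j) 0 = 0 := max_eq_right (neg_nonpos.2 (le_of_lt hk))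
  simp [hμ]

theorem tendsto_gamma_smul_gradient_infeasibility (h : p.IsPenaltySeq xbar γ x y Z ε) :
    Tendsto (fun k => γ k • gradient p.infeasibility (x k)) atTop (𝓝 (-gradient p.f xbar)) := by
  have hgradf : Continuous (gradient p.f) :=
    (InnerProductSpace.toDual ℝ _).symm.continuous.comp
      (p.contDiff_f.continuous_fderiv (by norm_num))
  rw [← zero_sub]
  refine (h.gradient_tendsto.sub ((hgradf.tendsto xbar).comp h.tendsto)).congr fun k => ?_
  rw [gradient_penalty, Function.comp_apply, add_sub_cancel_left]

theorem tendsto_gamma_mul_infeasibility (h : p.IsPenaltySeq xbar γ x y Z ε)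
    (hPL : p.GeneralizedPL xbar) (hxbar : p.Feasible xbar) :
    Tendsto (fun k => γ k * p.infeasibility (x k)) atTop (𝓝 0) := by
  classical
  obtain ⟨ν, hν, Ψ, hΨ, hineq⟩ := hPL
  rw [p.infeasibility_eq_zero_iff.2 hxbar] at hineq
  have hΨ₀ : Tendsto (Function.update Ψ xbar 0) (𝓝 xbar) (𝓝 0) := by
    simpa [ContinuousAt] using continuousAt_update_same.2 hΨ
  have hprod := (hΨ₀.comp h.tendsto).mul h.tendsto_gamma_smul_gradient_infeasibility.norm
  rw [zero_mul] at hprod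
  refine tendsto_of_tendsto_of_tendsto_of_le_of_le' tendsto_const_nhds hprod
    (.of_forall fun k => mul_nonneg (h.gamma_nonneg k) (p.infeasibility_nonneg _)) ?_
  filter_upwards [h.tendsto.eventually (Metric.closedBall_mem_nhds xbar hν)] with k hk
  rcases eq_or_ne (x k) xbar with hx | hx
  · simp [hx, p.infeasibility_eq_zero_iff.2 hxbar]
  calc γ k * p.infeasibility (x k)
      ≤ γ k * (Ψ (x k) * ‖gradient p.infeasibility (x k)‖) := by
        have hPLk := hineq _ hk
        rw [sub_zero, abs_of_nonneg (p.infeasibility_nonneg _)] at hPLk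
        exact mul_le_mul_of_nonneg_left hPLk (h.gamma_nonneg k)
    _ = (Function.update Ψ xbar 0 ∘ x) k * ‖γ k • gradient p.infeasibility (x k)‖ := by
        rw [Function.comp_apply, Function.update_of_ne hx, norm_smul,
          Real.norm_of_nonneg (h.gamma_nonneg k)]
        ring

theorem isCAKKT2Seq (h : p.IsPenaltySeq xbar γ x y Z ε) (hPL : p.GeneralizedPL xbar)
    (hxbar : p.Feasible xbar) : p.IsCAKKT2Seq xbar x y Z ε := by
  refine ⟨⟨h.posSemidef_Z, h.tendsto, h.tendsto_gradient_lagrangian, ?_⟩,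
    h.secondOrderSeq hxbar.2⟩
  have hbound := (h.tendsto_gamma_mul_infeasibility hPL hxbar).const_mul 4
  rw [mul_zero] at hbound
  refine tendsto_pi_nhds.2 fun i => tendsto_pi_nhds.2 fun j =>
    squeeze_zero_norm (fun k => ?_) hbound
  have hsymProd : symProd (p.G (x k)) (Z k) = -(γ k • matPos (-p.G (x k)) ^ 4) := by
    rw [← smul_neg, ← symProd_matPos_neg_pow (p.isSymm_G (x k)) 2, h.Z_eq, psdMultiplier]
    simp [symProd, smul_comm (γ k)]
  have hentry := abs_apply_le_trace (posSemidef_matPos_pow (p.isSymm_neg_G (x k)) 4) i j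
  calc ‖symProd (p.G (x k)) (Z k) i j‖ = γ k * |(matPos (-p.G (x k)) ^ 4) i j| := by
        rw [hsymProd, Real.norm_eq_abs, Matrix.neg_apply, Matrix.smul_apply, abs_neg, smul_eq_mul,
          abs_mul, abs_of_nonneg (h.gamma_nonneg k)]
    _ ≤ γ k * (4 * p.infeasibility (x k)) := by
        refine mul_le_mul_of_nonneg_left ?_ (h.gamma_nonneg k)
        rw [infeasibility]
        linarith [sq_nonneg ‖p.g (x k)‖]
    _ = 4 * (γ k * p.infeasibility (x k)) := by ring

end IsPenaltySeq

end PenaltySeq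

/-! ### Accumulation points of the penalty method -/

theorem exists_strictMono_tendsto_of_mapClusterPt {X : Type*} [TopologicalSpace X]
    [FirstCountableTopology X] {u : ℕ → X} {a : X} (ha : MapClusterPt a atTop u) (N : ℕ) :
    ∃ φ : ℕ → ℕ, StrictMono φ ∧ N ≤ φ 0 ∧ Tendsto (u ∘ φ) atTop (𝓝 a) := by
  obtain ⟨φ, hφ, hlim⟩ := ha.tendsto_subseq
  exact ⟨fun k => φ (k + N), hφ.comp (add_left_strictMono), by simpa using hφ.le_apply,
    hlim.comp (tendsto_add_atTop_nat N)⟩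

namespace IsPenaltyRun

variable {n m d : ℕ} {p : NSDP n m d} {η θ : ℝ} {δ γ : ℕ → ℝ}
  {x xhat : ℕ → EuclideanSpace ℝ (Fin n)}

theorem gamma_pos (h : p.IsPenaltyRun η θ δ γ x xhat) (k : ℕ) : 0 < γ k := by
  induction k with
  | zero => exact h.gamma_zero
  | succ k ih =>
    rw [h.gamma_succ]
    split_ifs
    · exact ih
    · exact mul_pos (zero_lt_one.trans h.one_lt_theta) ih

theorem gamma_le_succ (h : p.IsPenaltyRun η θ δ γ x xhat) (k : ℕ) : γ k ≤ γ (k + 1) := by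
  rw [h.gamma_succ]
  split_ifs
  · exact le_rfl
  · exact le_mul_of_one_le_left (h.gamma_pos k).le h.one_lt_theta.le

theorem gamma_succ_le (h : p.IsPenaltyRun η θ δ γ x xhat) (k : ℕ) : γ (k + 1) ≤ θ * γ k := by
  rw [h.gamma_succ]
  split_ifs
  · exact le_mul_of_one_le_left (h.gamma_pos k).le h.one_lt_theta.le
  · exact le_rfl

theorem penalty_succ_le (h : p.IsPenaltyRun η θ δ γ x xhat) {c : ℝ} (hc : ∀ k, c ≤ p.f (x k))
    (k : ℕ) : p.penalty (γ k) (x (k + 1)) ≤ p.f (x 0) + (θ - 1) * (p.f (x 0) - c) := by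
  have hθ : 0 ≤ θ - 1 := sub_nonneg.2 h.one_lt_theta.le
  have hstart (a : ℝ) : p.penalty a (x 0) ≤ p.f (x 0) + (θ - 1) * (p.f (x 0) - c) := by
    rw [penalty_eq, p.infeasibility_eq_zero_iff.2 h.feasible_zero, mul_zero]
    exact add_le_add_right (mul_nonneg hθ (sub_nonneg.2 (hc 0))) _
  refine (h.descent k).trans ?_
  cases k with
  | zero => exact h.xhat_zero.symm ▸ hstart _
  | succ k =>
    rw [h.xhat_succ]
    split_ifs with haccept
    · rw [penalty_eq] at haccept ⊢
      have hold : γ k * p.infeasibility (x (k + 1)) ≤ p.f (x 0) - c := by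
        linarith [hc (k + 1)]
      have hnew := mul_le_mul_of_nonneg_right (h.gamma_succ_le k)
        (p.infeasibility_nonneg (x (k + 1)))
      linarith [mul_le_mul_of_nonneg_left hold hθ]
    · exact hstart _

theorem tendsto_gamma_atTop (h : p.IsPenaltyRun η θ δ γ x xhat)
    (hincr : ∃ᶠ k in atTop, ¬ (k = 0 ∨ p.violation (x (k + 1)) ≤ η * p.violation (x k))) :
    Tendsto γ atTop atTop := by
  have hmono : Monotone γ := monotone_nat_of_le_succ h.gamma_le_succ
  refine (tendsto_atTop_of_monotone hmono).resolve_right fun ⟨a, ha⟩ => ?_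
  have hdiff : Tendsto (fun k => γ (k + 1) - γ k) atTop (𝓝 0) := by
    simpa using (ha.comp (tendsto_add_atTop_nat 1)).sub ha
  have hθ : 0 < θ - 1 := sub_pos.2 h.one_lt_theta
  obtain ⟨k, hk, hsmall⟩ := (hincr.and_eventually
    (hdiff.eventually_lt_const (mul_pos hθ h.gamma_zero))).exists
  rw [h.gamma_succ, if_neg hk] at hsmall
  linarith [mul_le_mul_of_nonneg_left (hmono (Nat.zero_le k)) hθ.le]

theorem tendsto_infeasibility_of_tendsto_gamma (h : p.IsPenaltyRun η θ δ γ x xhat)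
    (hbdd : BddBelow (Set.range fun k => p.f (x k))) (hγ : Tendsto γ atTop atTop) :
    Tendsto (fun k => p.infeasibility (x k)) atTop (𝓝 0) := by
  obtain ⟨c, hc⟩ := hbdd
  rw [mem_lowerBounds, Set.forall_mem_range] at hc
  rw [← tendsto_add_atTop_iff_nat 1]
  refine squeeze_zero (fun k => p.infeasibility_nonneg _) (fun k => ?_)
    (hγ.const_div_atTop (p.f (x 0) + (θ - 1) * (p.f (x 0) - c) - c))
  have hpenalty := h.penalty_succ_le hc k
  rw [penalty_eq] at hpenalty
  rw [le_div_iff₀' (h.gamma_pos k)]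
  linarith [hc (k + 1)]

theorem tendsto_infeasibility_of_eventually (h : p.IsPenaltyRun η θ δ γ x xhat)
    (hdecay : ∀ᶠ k in atTop, p.violation (x (k + 1)) ≤ η * p.violation (x k)) :
    Tendsto (fun k => p.infeasibility (x k)) atTop (𝓝 0) := by
  have hviol : Tendsto (fun k => p.violation (x k)) atTop (𝓝 0) := by
    refine (summable_of_ratio_norm_eventually_le h.eta_mem.2 ?_).tendsto_atTop_zero
    simpa only [Real.norm_of_nonneg (p.violation_nonneg _)] using hdecay
  refine squeeze_zero (fun k => p.infeasibility_nonneg _) (fun k => p.infeasibility_le _) ?_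
  simpa using ((hviol.pow 2).const_mul (1 / 2 : ℝ)).add ((hviol.pow 4).const_mul (1 / 4 : ℝ))

theorem tendsto_infeasibility (h : p.IsPenaltyRun η θ δ γ x xhat)
    (hbdd : BddBelow (Set.range fun k => p.f (x k))) :
    Tendsto (fun k => p.infeasibility (x k)) atTop (𝓝 0) := by
  by_cases hincr : ∃ᶠ k in atTop, ¬ (k = 0 ∨ p.violation (x (k + 1)) ≤ η * p.violation (x k))
  · exact h.tendsto_infeasibility_of_tendsto_gamma hbdd (h.tendsto_gamma_atTop hincr)
  · rw [not_frequently] at hincr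
    refine h.tendsto_infeasibility_of_eventually ?_
    filter_upwards [hincr, eventually_ne_atTop 0] with k hk hk₀
    exact (not_not.1 hk).resolve_left hk₀

theorem feasible_of_tendsto (h : p.IsPenaltyRun η θ δ γ x xhat)
    (hbdd : BddBelow (Set.range fun k => p.f (x k))) {xbar : EuclideanSpace ℝ (Fin n)}
    {φ : ℕ → ℕ} (hφ : StrictMono φ) (hlim : Tendsto (x ∘ φ) atTop (𝓝 xbar)) :
    p.Feasible xbar :=
  p.infeasibility_eq_zero_iff.1 (tendsto_nhds_unique
    ((p.continuous_infeasibility.tendsto xbar).comp hlim)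
    ((h.tendsto_infeasibility hbdd).comp hφ.tendsto_atTop))

theorem isPenaltySeq (h : p.IsPenaltyRun η θ δ γ x xhat) {y : ℕ → EuclideanSpace ℝ (Fin m)}
    {Z : ℕ → Matrix (Fin d) (Fin d) ℝ} {ε : ℕ → ℝ} {xbar : EuclideanSpace ℝ (Fin n)}
    (hy : ∀ k ≥ 1, y k = p.eqMultiplier (γ (k - 1)) (x k))
    (hZ : ∀ k ≥ 1, Z k = p.psdMultiplier (γ (k - 1)) (x k)) (hε : ∀ k ≥ 1, ε k = δ (k - 1))
    {φ : ℕ → ℕ} (hφ : StrictMono φ) (hφ₁ : 1 ≤ φ 0) (hlim : Tendsto (x ∘ φ) atTop (𝓝 xbar)) :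
    p.IsPenaltySeq xbar (fun k => γ (φ k - 1)) (x ∘ φ) (y ∘ φ) (Z ∘ φ) (ε ∘ φ) := by
  have hpos (k : ℕ) : 1 ≤ φ k := hφ₁.trans (hφ.monotone (Nat.zero_le k))
  have hε' : ε ∘ φ = fun k => δ (φ k - 1) := funext fun k => hε _ (hpos k)
  have hδ : Tendsto (fun k => δ (φ k - 1)) atTop (𝓝 0) :=
    h.delta_tendsto.comp ((tendsto_sub_atTop_nat 1).comp hφ.tendsto_atTop)
  rw [hε']
  refine ⟨hlim, fun k => (h.gamma_pos _).le, fun k => (h.delta_mem _).1, hδ,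
    squeeze_zero_norm (fun k => ?_) hδ, fun k => ?_,
    fun k => hy _ (hpos k), fun k => hZ _ (hpos k)⟩
  · simpa only [Function.comp_apply, Nat.sub_add_cancel (hpos k)] using h.gradient_le (φ k - 1)
  · simpa only [Function.comp_apply, Nat.sub_add_cancel (hpos k)] using
      h.hessian_posSemidef (φ k - 1)

end IsPenaltyRun

end

end NSDP

theorem mainTheorem2 {n m d : ℕ} (p : NSDP n m d) (η θ : ℝ) (δ γ : ℕ → ℝ)
    (x xhat : ℕ → EuclideanSpace ℝ (Fin n))
    (hrun : p.IsPenaltyRun η θ δ γ x xhat)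
    (hbdd : BddBelow (Set.range fun k => p.f (x k)))
    (y : ℕ → EuclideanSpace ℝ (Fin m)) (Z : ℕ → Matrix (Fin d) (Fin d) ℝ) (ε : ℕ → ℝ)
    (hy : ∀ k ≥ 1, y k = -(γ (k - 1) • p.g (x k)))
    (hZ : ∀ k ≥ 1, Z k = γ (k - 1) • NSDP.matPos (-p.G (x k)) ^ 3)
    (hε : ∀ k ≥ 1, ε k = δ (k - 1))
    (xbar : EuclideanSpace ℝ (Fin n)) (hacc : MapClusterPt xbar atTop x) :
    (p.IsAKKT2Point xbar ∧
      ∀ φ : ℕ → ℕ, StrictMono φ → 1 ≤ φ 0 → Tendsto (x ∘ φ) atTop (𝓝 xbar) →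
        ∃ ψ : ℕ → ℕ, StrictMono ψ ∧
          p.IsAKKT2Seq xbar (x ∘ φ ∘ ψ) (y ∘ φ ∘ ψ) (Z ∘ φ ∘ ψ) (ε ∘ φ ∘ ψ)) ∧
    (p.GeneralizedPL xbar →
      p.IsCAKKT2Point xbar ∧
      ∀ φ : ℕ → ℕ, StrictMono φ → 1 ≤ φ 0 → Tendsto (x ∘ φ) atTop (𝓝 xbar) →
        p.IsCAKKT2Seq xbar (x ∘ φ) (y ∘ φ) (Z ∘ φ) (ε ∘ φ)) := by
  obtain ⟨φ₀, hφ₀, hφ₀₁, hlim₀⟩ := NSDP.exists_strictMono_tendsto_of_mapClusterPt hacc 1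
  have hfeas : p.Feasible xbar := hrun.feasible_of_tendsto hbdd hφ₀ hlim₀
  have hAKKT2 (φ : ℕ → ℕ) (hφ : StrictMono φ) (hφ₁ : 1 ≤ φ 0)
      (hlim : Tendsto (x ∘ φ) atTop (𝓝 xbar)) : ∃ ψ : ℕ → ℕ, StrictMono ψ ∧
        p.IsAKKT2Seq xbar (x ∘ φ ∘ ψ) (y ∘ φ ∘ ψ) (Z ∘ φ ∘ ψ) (ε ∘ φ ∘ ψ) :=
    (hrun.isPenaltySeq hy hZ hε hφ hφ₁ hlim).exists_isAKKT2Seq hfeas.2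
  have hCAKKT2 (hPL : p.GeneralizedPL xbar) (φ : ℕ → ℕ) (hφ : StrictMono φ) (hφ₁ : 1 ≤ φ 0)
      (hlim : Tendsto (x ∘ φ) atTop (𝓝 xbar)) :
        p.IsCAKKT2Seq xbar (x ∘ φ) (y ∘ φ) (Z ∘ φ) (ε ∘ φ) :=
    (hrun.isPenaltySeq hy hZ hε hφ hφ₁ hlim).isCAKKT2Seq hPL hfeas
  obtain ⟨ψ, -, hψ⟩ := hAKKT2 φ₀ hφ₀ hφ₀₁ hlim₀
  exact ⟨⟨⟨hfeas, _, _, _, _, hψ⟩, hAKKT2⟩, fun hPL =>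
    ⟨⟨hfeas, _, _, _, _, hCAKKT2 hPL φ₀ hφ₀ hφ₀₁ hlim₀⟩, hCAKKT2 hPL⟩⟩
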